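/- For a half-integer $j\ge 0$ let $V^j$ be the spin-$j$ unitary irreducible representation of $SU(2)$, with orthonormal basis $|j,m\rangle$ and dimension $\mathrm d_j=2j+1$. Let $|j,n\rangle=n|j,j\rangle$ and $\overline{|j,n\rangle}=(-1)^{2j}\,n|j,-j\rangle$ $(n\in SU(2))$ be the two families of coherent states, and let $\mathrm dn$ be normalised Haar measure on $SU(2)$. For $|j^+-j^-|\le k\le j^++j^-$ with $j^++j^--k\in\mathbb Z$ let $C^{j^+j^-k}:V^{j^+}\otimes V^{j^-}\to V^k$ be the $SU(2)$-equivariant map ($SU(2)$ acting diagonally) with $C^{j^+j^-k}\,\overline{C^{j^+j^-k}}=\mathrm d_k^{-1}1_k$, where $\overline{C^{j^+j^-k}}$ is its adjoint, and with the Condon–Shortley phase $\langle k,k|C^{j^+j^-k}(|j^+,j^+\rangle\otimes|j^-,k-j^+\rangle)>0$; its matrix elements are $C^{j^+j^-k}_{m^+m^-m}=\langle k,m|C^{j^+j^-k}(|j^+,m^+\rangle\otimes|j^-,m^-\rangle)$. Put $$T_{j^+,j^-}=\mathrm d_{j^+}\mathrm d_{j^-}\int\mathrm dn\,|j^+,n\rangle\otimes|j^-,n\rangle\,\langle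 j^+,n|\otimes\langle j^-,n|,$$ $$G_{j^+,j^-}=\mathrm d_{j^+}\mathrm d_{j^-}\int\mathrm dn\,|j^+,n\rangle\otimes\overline{|j^-,n\rangle}\,\langle j^+,n|\otimes\overline{\langle j^-,n|}.$$ For real $\gamma>0$ let $\gamma^+=(1+\gamma)/\gamma$ and $\gamma^-=|1-\gamma|/\gamma$, and for a half-integer $j\ge 0$ such that $j\gamma^\pm$ are half-integers write $T_j^\gamma=T_{j\gamma^+,j\gamma^-}$ and $G_j^\gamma=G_{j\gamma^+,j\gamma^-}$. Then: (0) For all admissible $(j^+,j^-,k)$ the map $C^{j^+j^-k}$ exists, and $$C^{j^+j^-k}_{j^+,\,-j^-,\,j^+-j^-}=\left(\frac{(2j^+)!\,(2j^-)!}{(j^++j^--k)!\,(j^++j^-+k+1)!}\right)^{1/2}.$$ (1) If $0<\gamma<1$, then with $k=j(\gamma^++\gamma^-)$ $$T_j^\gamma=\mathrm d_{j\gamma^+}\mathrm d_{j\gamma^-}\,\overline{C^{j\gamma^+\,j\gamma^-\,k}}\;C^{j\gamma^+\,j\gamma^-\,k};$$ moreover $\frac{\mathrm d_k}{\mathrm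 d_{j\gamma^+}\mathrm d_{j\gamma^-}}T_j^\gamma$ is an orthogonal projection, and the range of $T_j^\gamma$ is the spin-$k$ component of $V^{j\gamma^+}\otimes V^{j\gamma^-}$. If $j>0$, the range of $T_j^\gamma$ does not contain the trivial representation of $SU(2)$. (2) If $\gamma>1$, then $$G_j^\gamma=\mathrm d_{j\gamma^+}\mathrm d_{j\gamma^-}\sum_{k=j(\gamma^+-\gamma^-)}^{j(\gamma^++\gamma^-)}\mathrm d_k\,\left|C^{j\gamma^+\,j\gamma^-\,k}_{j\gamma^+,\,-j\gamma^-,\,j(\gamma^+-\gamma^-)}\right|^2\,\overline{C^{j\gamma^+\,j\gamma^-\,k}}\;C^{j\gamma^+\,j\gamma^-\,k},$$ the sum being in integer steps. If $j>0$, the range of $G_j^\gamma$ does not contain the trivial representation of $SU(2)$. (3) If $\gamma=1$, then $j\gamma^+=2j$, $j\gamma^-=0$, and $T_j^1$ and $G_j^1$ are the identity operator. More generally $T_{j^+,0}=G_{j^+,0}=1$ for every half-integer $j^+\ge 0$. -/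

import Mathlib

open MeasureTheory Matrix
open scoped Kronecker

noncomputable section

/-- The group `SU(2)`, with the topology inherited from the complex `2 × 2` matrices. -/
abbrev SU2 : Type := Matrix.specialUnitaryGroup (Fin 2) ℂ

instance SU2.measurableSpace : MeasurableSpace SU2 := borel SU2

instance SU2.borelSpace : BorelSpace SU2 := ⟨rfl⟩

instance SU2.isTopologicalGroup : IsTopologicalGroup SU2 where
  continuous_mul := by fun_prop
  continuous_inv := by
    have h : Continuous fun g : SU2 => star (g : Matrix (Fin 2) (Fin 2) ℂ) := by fun_prop
    exact h.subtype_mk _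

instance SU2.compactSpace : CompactSpace SU2 := by
  have hc : IsClosed ((Matrix.specialUnitaryGroup (Fin 2) ℂ : Set (Matrix (Fin 2) (Fin 2) ℂ))) := by
    have : ((Matrix.specialUnitaryGroup (Fin 2) ℂ : Set (Matrix (Fin 2) (Fin 2) ℂ))) =
        {A | A * star A = 1} ∩ {A | A.det = 1} := by
      ext A
      simp [Matrix.mem_specialUnitaryGroup_iff, Matrix.mem_unitaryGroup_iff]
    rw [this]
    exact (isClosed_eq (by fun_prop) continuous_const).inter
      (isClosed_eq (by fun_prop) continuous_const)
  have hk : IsCompact (Set.pi Set.univ fun _ : Fin 2 => Set.pi Set.univ fun _ : Fin 2 =>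
      Metric.closedBall (0 : ℂ) 1) :=
    isCompact_univ_pi fun _ => isCompact_univ_pi fun _ => isCompact_closedBall _ _
  refine isCompact_iff_compactSpace.mp (hk.of_isClosed_subset hc ?_)
  intro A hA i _ j _
  simpa using entry_norm_bound_of_unitary (Matrix.specialUnitaryGroup_le_unitaryGroup hA) i j

/-- The normalised Haar measure of `SU(2)`. -/
def haarSU2 : Measure SU2 := Measure.haarMeasure ⊤

/-- The dimension `d_j = 2j + 1` of the spin `j` representation. Throughout, a spin `j` is encoded
by the natural number `n = 2j`, and a magnetic number `m` by the integer `2m`. -/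
def spinDim (n : ℕ) : ℂ := (n : ℂ) + 1

/-- The row `k`, column `l` matrix element of a `2 × 2` matrix `A` in the spin `n / 2`
representation, i.e. in the `n`-th symmetric power of `ℂ²`. The orthonormal basis vector with
index `l = j + m` is `|j,m⟩ = √(n choose l) e₁ ^ l e₂ ^ (n - l)`, and `A e₁ = A₀₀ e₁ + A₁₀ e₂`,
`A e₂ = A₀₁ e₁ + A₁₁ e₂`; the coefficient of `e₁ ^ k e₂ ^ (n - k)` in `A (e₁ ^ l e₂ ^ (n - l))` is
read off after setting `e₁ = X`, `e₂ = 1`. -/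
def wignerEntry (n : ℕ) (A : Matrix (Fin 2) (Fin 2) ℂ) (k l : Fin (n + 1)) : ℂ :=
  ((Real.sqrt (n.choose l) / Real.sqrt (n.choose k) : ℝ) : ℂ) *
    ((Polynomial.C (A 0 0) * Polynomial.X + Polynomial.C (A 1 0)) ^ (l : ℕ) *
      (Polynomial.C (A 0 1) * Polynomial.X + Polynomial.C (A 1 1)) ^ (n - (l : ℕ))).coeff k

section RepresentationLaw
open Polynomial

/-- The homogeneous substitution `e₁ ↦ P`, `e₂ ↦ Q` in a polynomial of formal degree `n`. -/
def homSubst (P Q : ℂ[X]) (n : ℕ) (p : ℂ[X]) : ℂ[X] :=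
  ∑ k ∈ Finset.range (n + 1), C (p.coeff k) * (P ^ k * Q ^ (n - k))

theorem homSubst_linear_mul (P Q : ℂ[X]) (a b : ℂ) (n : ℕ) (p : ℂ[X]) (hp : p.natDegree ≤ n) :
    homSubst P Q (n + 1) ((C a * X + C b) * p) = (C a * P + C b * Q) * homSubst P Q n p := by
  unfold homSubst
  have h0 : p.coeff (n + 1) = 0 := coeff_eq_zero_of_natDegree_lt (by omega)
  have hcoef : ∀ k, ((C a * X + C b) * p).coeff (k + 1) = a * p.coeff k + b * p.coeff (k + 1) := by
    intro k
    rw [add_mul, mul_assoc, coeff_add, coeff_C_mul, coeff_C_mul, coeff_X_mul]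
  have hcoef0 : ((C a * X + C b) * p).coeff 0 = b * p.coeff 0 := by
    rw [add_mul, mul_assoc, coeff_add, coeff_C_mul, coeff_C_mul, coeff_X_mul_zero]; ring
  rw [Finset.sum_range_succ', hcoef0]
  simp only [hcoef]
  simp only [C_add, C_mul, add_mul, Finset.sum_add_distrib]
  rw [add_assoc]
  congr 1
  · rw [Finset.mul_sum]
    refine Finset.sum_congr rfl fun k _ => ?_
    rw [Nat.add_sub_add_right]; ring
  · have := Finset.sum_range_succ'
      (fun k => C b * C (p.coeff k) * (P ^ k * Q ^ (n + 1 - k))) (n + 1)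
    rw [← this, Finset.sum_range_succ, h0, Finset.mul_sum]
    simp only [map_zero, mul_zero, zero_mul, add_zero]
    refine Finset.sum_congr rfl fun k hk => ?_
    have hk' : n + 1 - k = (n - k) + 1 := by have := Finset.mem_range.mp hk; omega
    rw [hk']; ring

theorem homSubst_pow (P Q : ℂ[X]) (a b c d : ℂ) (l m : ℕ) :
    homSubst P Q (l + m) ((C a * X + C b) ^ l * (C c * X + C d) ^ m) =
      (C a * P + C b * Q) ^ l * (C c * P + C d * Q) ^ m := by
  have hlin : ∀ a b : ℂ, (C a * X + C b).natDegree ≤ 1 := fun a b => natDegree_linear_le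
  have hdeg : ∀ m, ((C c * X + C d) ^ m).natDegree ≤ m := fun m =>
    natDegree_pow_le.trans (by simpa using Nat.mul_le_mul_left m (hlin c d))
  have hm : homSubst P Q m ((C c * X + C d) ^ m) = (C c * P + C d * Q) ^ m := by
    induction m with
    | zero => simp [homSubst]
    | succ m ih => rw [pow_succ', homSubst_linear_mul _ _ _ _ _ _ (hdeg m), ih, pow_succ']
  induction l with
  | zero => simpa using hm
  | succ l ih =>
    have hd : ((C a * X + C b) ^ l * (C c * X + C d) ^ m).natDegree ≤ l + m :=
      natDegree_mul_le.trans (add_le_add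
        (natDegree_pow_le.trans (by simpa using Nat.mul_le_mul_left l (hlin a b))) (hdeg m))
    rw [pow_succ', mul_assoc, show l + 1 + m = (l + m) + 1 by ring,
      homSubst_linear_mul _ _ _ _ _ _ hd, ih, pow_succ', mul_assoc]

theorem wignerEntry_mul (n : ℕ) (A B : Matrix (Fin 2) (Fin 2) ℂ) (k l : Fin (n + 1)) :
    wignerEntry n (A * B) k l = ∑ i, wignerEntry n A k i * wignerEntry n B i l := by
  have key := homSubst_pow (C (A 0 0) * X + C (A 1 0)) (C (A 0 1) * X + C (A 1 1))
    (B 0 0) (B 1 0) (B 0 1) (B 1 1) l (n - l)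
  rw [Nat.add_sub_cancel' (Nat.lt_succ_iff.mp l.2)] at key
  have e1 : C ((A * B) 0 0) * X + C ((A * B) 1 0) =
      C (B 0 0) * (C (A 0 0) * X + C (A 1 0)) + C (B 1 0) * (C (A 0 1) * X + C (A 1 1)) := by
    simp only [Matrix.mul_apply, Fin.sum_univ_two, C_add, C_mul]; ring
  have e2 : C ((A * B) 0 1) * X + C ((A * B) 1 1) =
      C (B 0 1) * (C (A 0 0) * X + C (A 1 0)) + C (B 1 1) * (C (A 0 1) * X + C (A 1 1)) := by
    simp only [Matrix.mul_apply, Fin.sum_univ_two, C_add, C_mul]; ring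
  unfold wignerEntry
  rw [e1, e2, ← key, homSubst, finsetSum_coeff, Finset.mul_sum, Finset.sum_range]
  refine Finset.sum_congr rfl fun i _ => ?_
  have hi : ((Real.sqrt (n.choose i) : ℝ) : ℂ) ≠ 0 := by
    have : 0 < n.choose (i : ℕ) := Nat.choose_pos (Nat.lt_succ_iff.mp i.2)
    exact_mod_cast (Real.sqrt_pos.mpr (by exact_mod_cast this)).ne'
  rw [coeff_C_mul]
  push_cast
  field_simp

theorem wignerEntry_one (n : ℕ) (k l : Fin (n + 1)) :
    wignerEntry n 1 k l = (1 : Matrix (Fin (n + 1)) (Fin (n + 1)) ℂ) k l := by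
  have hl : (Real.sqrt (n.choose l)) ≠ 0 := by
    have : 0 < n.choose (l : ℕ) := Nat.choose_pos (Nat.lt_succ_iff.mp l.2)
    exact (Real.sqrt_pos.mpr (by exact_mod_cast this)).ne'
  by_cases h : k = l
  · subst h
    simp [wignerEntry, hl]
  · have h' : (k : ℕ) ≠ l := fun e => h (Fin.ext e)
    simp [wignerEntry, coeff_X_pow, h', Matrix.one_apply_ne h]

end RepresentationLaw

/-- The spin `j = n / 2` representation of `SU(2)` on `V^j = ℂ^(2j+1)`, by the matrices
`t^j_{m m'}(g) = ⟨j,m| g |j,m'⟩` in the orthonormal basis `|j,m⟩`, `m = -j, …, j`. -/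
def spinRep (n : ℕ) : SU2 →* Matrix (Fin (n + 1)) (Fin (n + 1)) ℂ where
  toFun g := Matrix.of (wignerEntry n (g : Matrix (Fin 2) (Fin 2) ℂ))
  map_one' := by
    ext k l
    exact wignerEntry_one n k l
  map_mul' g h := by
    ext k l
    exact wignerEntry_mul n g h k l

/-- The position `j + m` of the basis vector `|j,m⟩`, for `n = 2j` and `M = 2m`
(meaningful when `|M| ≤ n` and `M ≡ n` modulo `2`). -/
def weightIndex (n : ℕ) (M : ℤ) : Fin (n + 1) := Fin.ofNat (n + 1) (((n : ℤ) + M) / 2).toNat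

/-- The basis vector `|j,m⟩`, for `n = 2j` and `M = 2m`. -/
def ket (n : ℕ) (M : ℤ) : Fin (n + 1) → ℂ := Pi.single (weightIndex n M) 1

/-- The coherent state `|j,g⟩ = g |j,j⟩`. -/
def coherentState (n : ℕ) (g : SU2) : Fin (n + 1) → ℂ := spinRep n g *ᵥ ket n n

/-- The conjugate coherent state `(-1)^(2j) g |j,-j⟩`. -/
def conjCoherentState (n : ℕ) (g : SU2) : Fin (n + 1) → ℂ :=
  (-1 : ℂ) ^ n • (spinRep n g *ᵥ ket n (-n))

/-- The vector `u ⊗ v` of `V^(a/2) ⊗ V^(b/2)`, whose basis is indexed by pairs. -/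
def tensorVec {a b : ℕ} (u : Fin (a + 1) → ℂ) (v : Fin (b + 1) → ℂ) :
    Fin (a + 1) × Fin (b + 1) → ℂ := fun p => u p.1 * v p.2

/-- The operator `∫ dg |ψ(g)⟩⟨ψ(g)|`, with respect to normalised Haar measure on `SU(2)`. -/
def ketBraIntegral {ι : Type*} (ψ : SU2 → ι → ℂ) : Matrix ι ι ℂ :=
  Matrix.of fun p q => ∫ g, Matrix.vecMulVec (ψ g) (star (ψ g)) p q ∂haarSU2

/-- The parallel coherent-state intertwiner
`T = d_{j⁺} d_{j⁻} ∫ dn |j⁺,n⟩ ⊗ |j⁻,n⟩ ⟨j⁺,n| ⊗ ⟨j⁻,n|` for `a = 2j⁺`, `b = 2j⁻`. -/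
def parallelIntertwiner (a b : ℕ) :
    Matrix (Fin (a + 1) × Fin (b + 1)) (Fin (a + 1) × Fin (b + 1)) ℂ :=
  (spinDim a * spinDim b) •
    ketBraIntegral fun g => tensorVec (coherentState a g) (coherentState b g)

/-- The anti-parallel coherent-state intertwiner: as `parallelIntertwiner`, with the conjugate
coherent state in the second factor. -/
def antiparallelIntertwiner (a b : ℕ) :
    Matrix (Fin (a + 1) × Fin (b + 1)) (Fin (a + 1) × Fin (b + 1)) ℂ :=
  (spinDim a * spinDim b) •
    ketBraIntegral fun g => tensorVec (coherentState a g) (conjCoherentState b g)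

/-- The spins `k` (doubled) with `|j⁺ - j⁻| ≤ k ≤ j⁺ + j⁻` and `j⁺ + j⁻ - k` an integer, for
`a = 2j⁺`, `b = 2j⁻`. -/
def coupledSpins (a b : ℕ) : Finset ℕ :=
  (Finset.range (a + b + 1)).filter fun k => a ≤ b + k ∧ b ≤ a + k ∧ Even (a + b + k)

/-- `C : V^(a/2) ⊗ V^(b/2) → V^(k/2)` is the normalised Clebsch-Gordan map: it is `SU(2)`-equivariant
(`SU(2)` acting diagonally on the tensor product), satisfies `C Cᴴ = (1 / d_k) 1`, and its phase is
fixed by the Condon-Shortley convention that the component of `C` from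
`|j⁺,j⁺⟩ ⊗ |j⁻,k-j⁺⟩` to `|k,k⟩` is positive. -/
structure IsClebschGordan (a b k : ℕ) (C : Matrix (Fin (k + 1)) (Fin (a + 1) × Fin (b + 1)) ℂ) :
    Prop where
  equivariant : ∀ g : SU2, C * (spinRep a g ⊗ₖ spinRep b g) = spinRep k g * C
  normalized : C * Cᴴ = (spinDim k)⁻¹ • (1 : Matrix (Fin (k + 1)) (Fin (k + 1)) ℂ)
  phase_im : (C (weightIndex k k) (weightIndex a a, weightIndex b (k - a))).im = 0
  phase_re : 0 < (C (weightIndex k k) (weightIndex a a, weightIndex b (k - a))).re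

open Classical in
/-- The normalised Clebsch-Gordan map `C^{j⁺ j⁻ k}`, for doubled spins `a`, `b`, `k`. Its conjugate
transpose is the map `V^k → V^{j⁺} ⊗ V^{j⁻}` with complex conjugate matrix elements. -/
def clebschGordan (a b k : ℕ) : Matrix (Fin (k + 1)) (Fin (a + 1) × Fin (b + 1)) ℂ :=
  if h : ∃ C, IsClebschGordan a b k C then h.choose else 0

/-- The Clebsch-Gordan coefficient `C^{j⁺ j⁻ k}_{m⁺ m⁻ m} = ⟨k,m| C (|j⁺,m⁺⟩ ⊗ |j⁻,m⁻⟩)`,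
with all labels doubled. -/
def cgCoeff (a b k : ℕ) (M₁ M₂ M : ℤ) : ℂ :=
  clebschGordan a b k (weightIndex k M) (weightIndex a M₁, weightIndex b M₂)

/-- `F : V^(k/2) → V^(a/2) ⊗ V^(b/2)` is equivariant for the diagonal action of `SU(2)`. -/
def IsEquivariantMap (a b k : ℕ)
    (F : Matrix (Fin (a + 1) × Fin (b + 1)) (Fin (k + 1)) ℂ) : Prop :=
  ∀ g : SU2, (spinRep a g ⊗ₖ spinRep b g) * F = F * spinRep k g

/-- The spin `k / 2` isotypic component of `V^(a/2) ⊗ V^(b/2)`: the sum of the ranges of all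
equivariant maps from the spin `k / 2` representation. -/
def spinComponent (a b k : ℕ) : Submodule ℂ (Fin (a + 1) × Fin (b + 1) → ℂ) :=
  ⨆ F : {F : Matrix (Fin (a + 1) × Fin (b + 1)) (Fin (k + 1)) ℂ // IsEquivariantMap a b k F},
    LinearMap.range F.1.mulVecLin

/-- The trivial representation occurs in the range of the operator `A` on `V^(a/2) ⊗ V^(b/2)`:
the range contains a nonzero vector that is fixed by the diagonal action of `SU(2)`. -/
def ContainsTrivialRep (a b : ℕ)
    (A : Matrix (Fin (a + 1) × Fin (b + 1)) (Fin (a + 1) × Fin (b + 1)) ℂ) : Prop :=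
  ∃ v ∈ LinearMap.range A.mulVecLin, v ≠ 0 ∧
    ∀ g : SU2, (spinRep a g ⊗ₖ spinRep b g) *ᵥ v = v

/-- `γ⁺ = (1 + γ) / γ`. -/
def immirziPlus (γ : ℝ) : ℝ := (1 + γ) / γ

/-- `γ⁻ = |1 - γ| / γ`, i.e. `(1 - γ) / γ` for `γ ≤ 1` and `(γ - 1) / γ` for `γ ≥ 1`. -/
def immirziMinus (γ : ℝ) : ℝ := |1 - γ| / γ

/-- The half-integers `j`, `j⁺`, `j⁻` (given as `n / 2`, `a / 2`, `b / 2`) satisfy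
`j⁺ = γ⁺ j` and `j⁻ = γ⁻ j`. -/
def ImmirziSpins (γ : ℝ) (n a b : ℕ) : Prop :=
  (a : ℝ) / 2 = immirziPlus γ * ((n : ℝ) / 2) ∧ (b : ℝ) / 2 = immirziMinus γ * ((n : ℝ) / 2)

end

/-!
Everything is deduced from the decomposition of `V^(a/2) ⊗ V^(b/2)` under `SU(2)`.

The vectors `cohVec n u`, powers of linear forms, span the spin `n / 2` representation and are
permuted by the group, so an operator is determined by its generating function on them. The
invariant function `(x·u) ^ s (y·u) ^ t (x₀ y₁ - x₁ y₀) ^ r` is the generating function of an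
equivariant map `couplingMap` from spin `(s + t) / 2` to `V^((s+r)/2) ⊗ V^((t+r)/2)`. Its transpose
is, up to a positive factor, the Clebsch-Gordan map (`isClebschGordan_couplingMap`); the factor is
the squared norm of one column, evaluated by a Chu-Vandermonde sum (`sum_couplingCoeff_last_sq`).
The closed form of the extremal coefficient follows, once the Clebsch-Gordan map is known to be
unique (`eq_clebschGordan`).

Schur's lemma is elementary here (`intertwiner_eq_zero`, `intertwiner_eq_smul_one`): the diagonal
torus forces an intertwiner to preserve weights, and applying it to a rotated highest weight vector
with no vanishing component relates all its entries. With invariance of Haar measure this gives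
Schur orthogonality for averages, and with a count of dimensions the completeness relation
`∑ d_k Cᴴ C = 1` (`sum_clebschGordan`).

Both intertwiners are averages of `|g v⟩⟨g v|` for a basis vector `v` of the tensor product. By
`ketBraIntegral_orbit` such an average is `∑ d_k ‖C v‖² Cᴴ C`. For the parallel intertwiner, `v` is
the highest weight vector, which lies in the component of top spin; for the antiparallel one `C v`
is given by the extremal coefficient. When the two spins differ, spin `0` does not occur in the
decomposition at all, so no range contains the trivial representation.
-/

/-! ### Powers of linear forms -/

/-- The `n`-th power of the linear form `u₀ e₁ + u₁ e₂`, in the orthonormal basis of the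
spin `n / 2` representation: an unnormalised coherent state, defined for every `u ∈ ℂ²`. -/
noncomputable def cohVec (n : ℕ) (u : Fin 2 → ℂ) : Fin (n + 1) → ℂ := fun l =>
  ((Real.sqrt (n.choose l) : ℝ) : ℂ) * (u 0 ^ (l : ℕ) * u 1 ^ (n - (l : ℕ)))

/-- The spin `n / 2` representation extended to all complex `2 × 2` matrices. -/
noncomputable def wignerMatrix (n : ℕ) (A : Matrix (Fin 2) (Fin 2) ℂ) :
    Matrix (Fin (n + 1)) (Fin (n + 1)) ℂ :=
  Matrix.of (wignerEntry n A)

theorem spinRep_eq_wignerMatrix (n : ℕ) (g : SU2) : spinRep n g = wignerMatrix n g := rfl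

theorem sqrt_choose_ne_zero {n l : ℕ} (h : l ≤ n) : ((Real.sqrt (n.choose l) : ℝ) : ℂ) ≠ 0 := by
  have : 0 < n.choose l := Nat.choose_pos h
  exact_mod_cast (Real.sqrt_pos.mpr (by exact_mod_cast this)).ne'

theorem sqrt_choose_mul_self (n l : ℕ) :
    ((Real.sqrt (n.choose l) : ℝ) : ℂ) * ((Real.sqrt (n.choose l) : ℝ) : ℂ) = n.choose l := by
  rw [← Complex.ofReal_mul, Real.mul_self_sqrt (Nat.cast_nonneg _), Complex.ofReal_natCast]

theorem cohVec_dotProduct (n : ℕ) (x y : Fin 2 → ℂ) :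
    cohVec n x ⬝ᵥ cohVec n y = (x ⬝ᵥ y) ^ n := by
  simp only [dotProduct, Fin.sum_univ_two, add_pow, cohVec]
  rw [Finset.sum_range]
  refine Finset.sum_congr rfl fun l _ => ?_
  rw [← sqrt_choose_mul_self n l]
  ring

theorem wignerMatrix_mulVec_cohVec (n : ℕ) (A : Matrix (Fin 2) (Fin 2) ℂ) (u : Fin 2 → ℂ) :
    wignerMatrix n A *ᵥ cohVec n u = cohVec n (A *ᵥ u) := by
  open Polynomial in
  ext k
  have hk := sqrt_choose_ne_zero (Nat.lt_succ_iff.mp k.2)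
  -- both sides are read off from the coefficient of `X ^ k` in the `n`-th power of a linear form
  have e : C (u 0) * (C (A 0 0) * X + C (A 1 0)) + C (u 1) * (C (A 0 1) * X + C (A 1 1)) =
      C ((A *ᵥ u) 0) * X + C ((A *ᵥ u) 1) := by
    simp only [Matrix.mulVec, dotProduct, Fin.sum_univ_two, C_add, C_mul]; ring
  have hmon : ∀ (z w : ℂ) (l m c : ℕ),
      (C z * X) ^ l * C w ^ m * (c : ℂ[X]) = C (z ^ l * w ^ m * c) * X ^ l := fun z w l m c => by
    rw [mul_pow, ← C_eq_natCast, C_mul, C_mul, C_pow, C_pow]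
    ring
  have key := congrArg (fun p => (p ^ n).coeff (k : ℕ)) e
  simp only [add_pow (C (u 0) * _), add_pow (C ((A *ᵥ u) 0) * _), finsetSum_coeff] at key
  rw [Finset.sum_range, Finset.sum_eq_single (a := (k : ℕ)) (s := Finset.range (n + 1))] at key
  · simp only [Matrix.mulVec, dotProduct, wignerMatrix, wignerEntry, cohVec,
      Matrix.of_apply] at key ⊢
    have : ∀ c : ℂ, ((Real.sqrt (n.choose k) : ℝ) : ℂ) * (((Real.sqrt (n.choose k) : ℝ) : ℂ) * c)
        = n.choose k * c := fun c => by rw [← mul_assoc, sqrt_choose_mul_self]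
    rw [← mul_right_inj' hk, this, Finset.mul_sum]
    rw [hmon, coeff_C_mul, coeff_X_pow_self, mul_one] at key
    rw [← mul_comm (_ * _ : ℂ), ← key]
    refine Finset.sum_congr rfl fun l _ => ?_
    rw [mul_pow, mul_pow, ← C_pow, ← C_pow, ← C_eq_natCast]
    rw [show ∀ p q r s t : ℂ[X], p * q * (r * s) * t = p * r * t * (q * s) by intros; ring]
    rw [← C_mul, ← C_mul, coeff_C_mul, ← sqrt_choose_mul_self n l]
    push_cast
    field_simp
  · intro l _ hl
    rw [hmon, coeff_C_mul, coeff_X_pow, if_neg (Ne.symm hl), mul_zero]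
  · intro h
    exact absurd (Finset.mem_range.mpr k.2) h

/-- The vectors `cohVec n u` span: a vector `w` orthogonal to all of them gives a polynomial
`∑ √(n choose l) w_l z ^ l` that vanishes at every `z`. -/
theorem eq_zero_of_cohVec_dotProduct {n : ℕ} {w : Fin (n + 1) → ℂ}
    (h : ∀ u, cohVec n u ⬝ᵥ w = 0) : w = 0 := by
  open Polynomial in
  set p : ℂ[X] := ∑ l : Fin (n + 1),
    C (((Real.sqrt (n.choose l) : ℝ) : ℂ) * w l) * X ^ (l : ℕ) with hp
  have h0 : p = 0 := by
    refine Polynomial.funext fun z => ?_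
    have := h ![z, 1]
    simp only [dotProduct, cohVec] at this
    simp only [hp, eval_finsetSum, eval_mul, eval_C, eval_pow, eval_X, eval_zero]
    rw [← this]
    refine Finset.sum_congr rfl fun l _ => ?_
    simp
    ring
  ext l
  have := congrArg (fun p => p.coeff (l : ℕ)) h0
  simp only [hp, finsetSum_coeff, coeff_C_mul, coeff_X_pow, coeff_zero, Fin.val_inj] at this
  simp only [mul_ite, mul_one, mul_zero, Finset.sum_ite_eq, Finset.mem_univ, if_true] at this
  exact (mul_eq_zero.mp this).resolve_left (sqrt_choose_ne_zero (Nat.lt_succ_iff.mp l.2))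

theorem eq_of_cohVec_dotProduct {n : ℕ} {v w : Fin (n + 1) → ℂ}
    (h : ∀ u, cohVec n u ⬝ᵥ v = cohVec n u ⬝ᵥ w) : v = w :=
  sub_eq_zero.mp <| eq_zero_of_cohVec_dotProduct fun u => by rw [dotProduct_sub, h, sub_self]

theorem eq_of_mulVec_cohVec {ι : Type*} {n : ℕ} {M N : Matrix ι (Fin (n + 1)) ℂ}
    (h : ∀ u, M *ᵥ cohVec n u = N *ᵥ cohVec n u) : M = N := by
  ext i
  refine congrFun (eq_of_cohVec_dotProduct (v := M i) (w := N i) fun u => ?_) _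
  rw [dotProduct_comm, dotProduct_comm _ (N i)]
  exact congrFun (h u) i

theorem tensorVec_dotProduct {a b : ℕ} (u : Fin (a + 1) → ℂ) (v : Fin (b + 1) → ℂ)
    (w : Fin (a + 1) × Fin (b + 1) → ℂ) :
    tensorVec u v ⬝ᵥ w = u ⬝ᵥ fun p => v ⬝ᵥ fun q => w (p, q) := by
  simp only [dotProduct, tensorVec, Fintype.sum_prod_type, Finset.mul_sum, mul_assoc]

theorem eq_of_tensorVec_cohVec_dotProduct {a b : ℕ} {v w : Fin (a + 1) × Fin (b + 1) → ℂ}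
    (h : ∀ x y, tensorVec (cohVec a x) (cohVec b y) ⬝ᵥ v =
      tensorVec (cohVec a x) (cohVec b y) ⬝ᵥ w) : v = w := by
  ext ⟨p, q⟩
  simp only [tensorVec_dotProduct] at h
  have h1 : ∀ y, (fun p => cohVec b y ⬝ᵥ fun q => v (p, q)) =
      fun p => cohVec b y ⬝ᵥ fun q => w (p, q) := fun y => eq_of_cohVec_dotProduct fun x => h x y
  exact congrFun (eq_of_cohVec_dotProduct (v := fun q => v (p, q)) (w := fun q => w (p, q))
    fun y => congrFun (h1 y) p) q

theorem kronecker_mulVec_tensorVec {a b : ℕ} (M : Matrix (Fin (a + 1)) (Fin (a + 1)) ℂ)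
    (N : Matrix (Fin (b + 1)) (Fin (b + 1)) ℂ) (u : Fin (a + 1) → ℂ) (v : Fin (b + 1) → ℂ) :
    (M ⊗ₖ N) *ᵥ tensorVec u v = tensorVec (M *ᵥ u) (N *ᵥ v) := by
  ext ⟨p, q⟩
  simp only [mulVec, dotProduct, tensorVec, Fintype.sum_prod_type, kroneckerMap_apply,
    Finset.sum_mul_sum]
  exact Finset.sum_congr rfl fun _ _ => Finset.sum_congr rfl fun _ _ => by ring

/-- The representation is compatible with transposition, because `cohVec n x ⬝ᵥ cohVec n y` is the
power `(x ⬝ᵥ y) ^ n` of an invariant pairing. -/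
theorem wignerMatrix_transpose (n : ℕ) (A : Matrix (Fin 2) (Fin 2) ℂ) :
    wignerMatrix n Aᵀ = (wignerMatrix n A)ᵀ := by
  refine eq_of_mulVec_cohVec fun u => eq_of_cohVec_dotProduct fun x => ?_
  rw [wignerMatrix_mulVec_cohVec, cohVec_dotProduct, dotProduct_mulVec (cohVec n x),
    vecMul_transpose, wignerMatrix_mulVec_cohVec, cohVec_dotProduct, dotProduct_mulVec,
    vecMul_transpose]

theorem cohVec_star (n : ℕ) (u : Fin 2 → ℂ) : cohVec n (star u) = star (cohVec n u) := by
  ext l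
  simp [cohVec]

theorem wignerMatrix_conjTranspose (n : ℕ) (A : Matrix (Fin 2) (Fin 2) ℂ) :
    wignerMatrix n Aᴴ = (wignerMatrix n A)ᴴ := by
  have hs : ∀ {m : ℕ} (M : Matrix (Fin m) (Fin m) ℂ) (v : Fin m → ℂ),
      (Mᴴ)ᵀ *ᵥ star v = star (M *ᵥ v) := fun M v => by
    rw [star_mulVec, mulVec_transpose]
  rw [← transpose_inj, ← wignerMatrix_transpose]
  refine eq_of_mulVec_cohVec fun u => ?_
  rw [wignerMatrix_mulVec_cohVec, ← star_star u, hs, cohVec_star, cohVec_star, hs,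
    wignerMatrix_mulVec_cohVec]

theorem spinRep_inv (n : ℕ) (g : SU2) : spinRep n g⁻¹ = (spinRep n g)ᴴ := by
  rw [spinRep_eq_wignerMatrix, spinRep_eq_wignerMatrix, ← wignerMatrix_conjTranspose]
  rfl

theorem spinRep_conjTranspose_mul (n : ℕ) (g : SU2) : (spinRep n g)ᴴ * spinRep n g = 1 := by
  rw [← spinRep_inv, ← map_mul, inv_mul_cancel, map_one]

/-! ### The coupling map -/

/-- The coefficient of `x₀ ^ p x₁ ^ (s + r - p) y₀ ^ q y₁ ^ (t + r - q) u₀ ^ m u₁ ^ (s + t - m)` in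
`(x₀ u₀ + x₁ u₁) ^ s (y₀ u₀ + y₁ u₁) ^ t (x₀ y₁ - x₁ y₀) ^ r`. -/
noncomputable def couplingCoeff (r s t p q m : ℕ) : ℝ :=
  ∑ i ∈ Finset.range (s + 1), ∑ j ∈ Finset.range (t + 1), ∑ l ∈ Finset.range (r + 1),
    if p = i + l ∧ q = j + (r - l) ∧ m = i + j then
      (s.choose i * t.choose j * r.choose l : ℝ) * (-1) ^ (r - l) else 0

/-- The embedding `V^((s+t)/2) → V^((s+r)/2) ⊗ V^((t+r)/2)`, not normalised, whose generating
function is `(x·u) ^ s (y·u) ^ t (x ∧ y) ^ r`. Every admissible triple of doubled spins has the form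
`(s + r, t + r, s + t)`. -/
noncomputable def couplingMap (r s t : ℕ) :
    Matrix (Fin (s + r + 1) × Fin (t + r + 1)) (Fin (s + t + 1)) ℂ :=
  Matrix.of fun pq m => ((couplingCoeff r s t pq.1 pq.2 m /
    (√((s + r).choose pq.1) * √((t + r).choose pq.2) * √((s + t).choose m)) : ℝ) : ℂ)

/-- Extraction of the defining sum of `couplingCoeff`: each triple `(i, j, l)` contributes to
exactly one triple of exponents, which lies in the range of summation. -/
theorem sum_couplingCoeff_mul (r s t : ℕ) (f : ℕ → ℕ → ℕ → ℂ) :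
    ∑ p ∈ Finset.range (s + r + 1), ∑ q ∈ Finset.range (t + r + 1), ∑ m ∈ Finset.range (s + t + 1),
      (couplingCoeff r s t p q m : ℂ) * f p q m =
    ∑ i ∈ Finset.range (s + 1), ∑ j ∈ Finset.range (t + 1), ∑ l ∈ Finset.range (r + 1),
      (s.choose i * t.choose j * r.choose l : ℂ) * (-1) ^ (r - l) *
        f (i + l) (j + (r - l)) (i + j) := by
  simp only [couplingCoeff, Complex.ofReal_sum, Finset.sum_mul]
  have e : ∀ p q m i j l, ((((if p = i + l ∧ q = j + (r - l) ∧ m = i + j then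
      (s.choose i * t.choose j * r.choose l : ℝ) * (-1) ^ (r - l) else 0 : ℝ)) : ℂ) * f p q m) =
      if p = i + l then if q = j + (r - l) then if m = i + j then
        (s.choose i * t.choose j * r.choose l : ℂ) * (-1) ^ (r - l) *
        f (i + l) (j + (r - l)) (i + j) else 0 else 0 else 0 := by
    intro p q m i j l
    by_cases h1 : p = i + l <;> by_cases h2 : q = j + (r - l) <;> by_cases h3 : m = i + j <;>
      simp [h1, h2, h3]
  simp only [e]
  -- move the sums over `m`, `q` and `p` inwards in turn, then collapse them
  calc _ = ∑ p ∈ Finset.range (s + r + 1), ∑ q ∈ Finset.range (t + r + 1),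
        ∑ i ∈ Finset.range (s + 1), ∑ j ∈ Finset.range (t + 1), ∑ l ∈ Finset.range (r + 1),
        ∑ m ∈ Finset.range (s + t + 1), _ := Finset.sum_congr rfl fun p _ =>
          Finset.sum_congr rfl fun q _ => by
        rw [Finset.sum_comm]
        refine Finset.sum_congr rfl fun i _ => ?_
        rw [Finset.sum_comm]
        refine Finset.sum_congr rfl fun j _ => ?_
        rw [Finset.sum_comm]
    _ = ∑ p ∈ Finset.range (s + r + 1),
        ∑ i ∈ Finset.range (s + 1), ∑ j ∈ Finset.range (t + 1), ∑ l ∈ Finset.range (r + 1),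
        ∑ q ∈ Finset.range (t + r + 1), ∑ m ∈ Finset.range (s + t + 1), _ :=
          Finset.sum_congr rfl fun p _ => by
        rw [Finset.sum_comm]
        refine Finset.sum_congr rfl fun i _ => ?_
        rw [Finset.sum_comm]
        refine Finset.sum_congr rfl fun j _ => ?_
        rw [Finset.sum_comm]
    _ = ∑ i ∈ Finset.range (s + 1), ∑ j ∈ Finset.range (t + 1), ∑ l ∈ Finset.range (r + 1),
        ∑ p ∈ Finset.range (s + r + 1),
        ∑ q ∈ Finset.range (t + r + 1), ∑ m ∈ Finset.range (s + t + 1), _ := by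
        rw [Finset.sum_comm]
        refine Finset.sum_congr rfl fun i _ => ?_
        rw [Finset.sum_comm]
        refine Finset.sum_congr rfl fun j _ => ?_
        rw [Finset.sum_comm]
    _ = _ := by
        refine Finset.sum_congr rfl fun i hi => Finset.sum_congr rfl fun j hj =>
          Finset.sum_congr rfl fun l hl => ?_
        rw [Finset.mem_range] at hi hj hl
        rw [Finset.sum_eq_single (i + l), Finset.sum_eq_single (j + (r - l)),
          Finset.sum_eq_single (i + j)]
        · simp
        · intro m _ h; simp [h]
        · intro h; rw [Finset.mem_range] at h; omega
        · intro m _ h; simp [h]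
        · intro h; rw [Finset.mem_range] at h; omega
        · intro m _ h; simp [h]
        · intro h; rw [Finset.mem_range] at h; omega

/-- The generating function of `couplingMap`, which determines it because the vectors `cohVec n u`
span. -/
theorem couplingMap_generating (r s t : ℕ) (x y u : Fin 2 → ℂ) :
    tensorVec (cohVec (s + r) x) (cohVec (t + r) y) ⬝ᵥ (couplingMap r s t *ᵥ cohVec (s + t) u) =
      (x ⬝ᵥ u) ^ s * (y ⬝ᵥ u) ^ t * (x 0 * y 1 - x 1 * y 0) ^ r := by
  have h := sum_couplingCoeff_mul r s t fun p q m =>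
    (x 0 ^ p * x 1 ^ (s + r - p)) * (y 0 ^ q * y 1 ^ (t + r - q)) *
      (u 0 ^ m * u 1 ^ (s + t - m))
  calc _ = _ := ?_
    _ = _ := h
    _ = _ := ?_
  · simp only [Finset.sum_range, dotProduct, Fintype.sum_prod_type, mulVec, Finset.mul_sum]
    refine Finset.sum_congr rfl fun p _ => Finset.sum_congr rfl fun q _ =>
      Finset.sum_congr rfl fun m _ => ?_
    have hp := sqrt_choose_ne_zero (Nat.lt_succ_iff.mp p.2)
    have hq := sqrt_choose_ne_zero (Nat.lt_succ_iff.mp q.2)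
    have hm := sqrt_choose_ne_zero (Nat.lt_succ_iff.mp m.2)
    simp only [tensorVec, cohVec, couplingMap, of_apply]
    push_cast
    field_simp
  · simp only [dotProduct, Fin.sum_univ_two]
    rw [add_pow, add_pow, sub_eq_add_neg, add_pow, Finset.sum_mul_sum, Finset.sum_mul]
    refine Finset.sum_congr rfl fun i hi => ?_
    rw [Finset.sum_mul_sum]
    refine Finset.sum_congr rfl fun j hj => Finset.sum_congr rfl fun l hl => ?_
    rw [Finset.mem_range] at hi hj hl
    obtain ⟨i', rfl⟩ := Nat.exists_eq_add_of_le (Nat.lt_succ_iff.mp hi)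
    obtain ⟨j', rfl⟩ := Nat.exists_eq_add_of_le (Nat.lt_succ_iff.mp hj)
    obtain ⟨l', rfl⟩ := Nat.exists_eq_add_of_le (Nat.lt_succ_iff.mp hl)
    have e1 : i + i' + (l + l') - (i + l) = i' + l' := by omega
    have e2 : j + j' + (l + l') - (j + l') = j' + l := by omega
    have e3 : i + i' + (j + j') - (i + j) = i' + j' := by omega
    simp only [Nat.add_sub_cancel_left, e1, e2, e3]
    rw [neg_pow (x 1 * y 0)]
    ring

/-- The generating function is invariant under matrices of determinant `1`: `A` moves across the
pairings `x·u` and `y·u` as its transpose, and `Aᵀx ∧ Aᵀy = det A (x ∧ y)`. -/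
theorem couplingMap_equivariant (r s t : ℕ) {A : Matrix (Fin 2) (Fin 2) ℂ} (hA : A.det = 1) :
    (wignerMatrix (s + r) A ⊗ₖ wignerMatrix (t + r) A) * couplingMap r s t =
      couplingMap r s t * wignerMatrix (s + t) A := by
  refine eq_of_mulVec_cohVec fun u => eq_of_tensorVec_cohVec_dotProduct fun x y => ?_
  rw [← mulVec_mulVec, ← mulVec_mulVec, wignerMatrix_mulVec_cohVec, couplingMap_generating,
    dotProduct_mulVec, ← mulVec_transpose, ← kroneckerMap_transpose, kronecker_mulVec_tensorVec,
    ← wignerMatrix_transpose, ← wignerMatrix_transpose, wignerMatrix_mulVec_cohVec,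
    wignerMatrix_mulVec_cohVec, couplingMap_generating, dotProduct_mulVec, dotProduct_mulVec,
    mulVec_transpose, mulVec_transpose]
  congr 2
  rw [det_fin_two] at hA
  simp only [vecMul, dotProduct, Fin.sum_univ_two]
  linear_combination (x 0 * y 1 - x 1 * y 0) * hA

/-- The coupling map preserves weights. -/
theorem couplingCoeff_eq_zero {r s t p q m : ℕ} (h : p + q ≠ m + r) :
    couplingCoeff r s t p q m = 0 :=
  Finset.sum_eq_zero fun i _ => Finset.sum_eq_zero fun j _ => Finset.sum_eq_zero fun l hl =>
    if_neg fun h' => h (by have := Finset.mem_range.mp hl; omega)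

theorem couplingCoeff_extremal (r s t : ℕ) : couplingCoeff r s t (s + r) 0 s = 1 := by
  unfold couplingCoeff
  rw [Finset.sum_eq_single s, Finset.sum_eq_single 0, Finset.sum_eq_single r]
  · simp
  · intro l hl h; rw [if_neg]; rw [Finset.mem_range] at hl; omega
  · simp
  · intro j hj h; refine Finset.sum_eq_zero fun l hl => ?_; rw [if_neg]; omega
  · simp
  · intro i hi h
    refine Finset.sum_eq_zero fun j hj => Finset.sum_eq_zero fun l hl => ?_
    rw [if_neg]; simp only [Finset.mem_range] at hi hj hl; omega
  · simp

theorem couplingCoeff_last (r s t l : ℕ) (hl : l ≤ r) :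
    couplingCoeff r s t (s + l) (t + (r - l)) (s + t) = r.choose l * (-1) ^ (r - l) := by
  unfold couplingCoeff
  rw [Finset.sum_eq_single s, Finset.sum_eq_single t, Finset.sum_eq_single l]
  · simp
  · intro l' hl' h; rw [if_neg]; omega
  · intro h; rw [Finset.mem_range] at h; omega
  · intro j hj h; refine Finset.sum_eq_zero fun l hl => ?_; rw [if_neg]; omega
  · simp
  · intro i hi h
    refine Finset.sum_eq_zero fun j hj => Finset.sum_eq_zero fun l hl => ?_
    rw [if_neg]; simp only [Finset.mem_range] at hi hj hl; omega
  · simp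

theorem couplingCoeff_last_eq_zero {r s t p q : ℕ} (hp : p < s) :
    couplingCoeff r s t p q (s + t) = 0 :=
  Finset.sum_eq_zero fun i hi => Finset.sum_eq_zero fun j hj => Finset.sum_eq_zero fun l hl =>
    if_neg (by simp only [Finset.mem_range] at hi hj hl; omega)

/-- A Chu-Vandermonde identity: compare coefficients in
`(1 - X)^(-(s+1)) (1 - X)^(-(t+1)) = (1 - X)^(-(s+t+2))`. -/
theorem sum_choose_mul_choose (r s t : ℕ) :
    ∑ l ∈ Finset.range (r + 1), (s + l).choose s * (t + (r - l)).choose t =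
      (s + t + 1 + r).choose (s + t + 1) := by
  have h := PowerSeries.invOneSubPow_add (S := ℤ) (s + 1) (t + 1)
  have h2 := congrArg (fun z => PowerSeries.coeff r z.val) h
  simp only [Units.val_mul, PowerSeries.coeff_mul] at h2
  rw [show s + 1 + (t + 1) = (s + t + 1) + 1 by ring] at h2
  simp only [PowerSeries.invOneSubPow_val_succ_eq_mk_add_choose, PowerSeries.coeff_mk] at h2
  rw [Finset.Nat.sum_antidiagonal_eq_sum_range_succ
    (fun i j => ((s + i).choose s : ℤ) * ((t + j).choose t : ℤ))] at h2
  exact_mod_cast h2.symm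

/-- The scalar by which `couplingMap` scales squared norms. -/
noncomputable def couplingNorm (r s t : ℕ) : ℝ :=
  (r.factorial * (s + t + 1 + r).factorial * s.factorial * t.factorial : ℝ) /
    ((s + t + 1).factorial * (s + r).factorial * (t + r).factorial)

theorem couplingNorm_pos (r s t : ℕ) : 0 < couplingNorm r s t := by
  unfold couplingNorm; positivity

theorem sum_couplingCoeff_last_sq (r s t : ℕ) :
    ∑ l ∈ Finset.range (r + 1), ((r.choose l : ℝ)) ^ 2 /
      ((s + r).choose (s + l) * (t + r).choose (t + (r - l))) = couplingNorm r s t := by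
  have h : ((∑ l ∈ Finset.range (r + 1), (s + l).choose s * (t + (r - l)).choose t : ℕ) : ℝ) =
      (s + t + 1 + r).choose (s + t + 1) := by rw [sum_choose_mul_choose]
  have hn : couplingNorm r s t = ((r.factorial : ℝ) ^ 2 * s.factorial * t.factorial /
      ((s + r).factorial * (t + r).factorial)) * (s + t + 1 + r).choose (s + t + 1) := by
    rw [couplingNorm, Nat.cast_add_choose]
    field_simp
  rw [hn, ← h, Nat.cast_sum, Finset.mul_sum]
  refine Finset.sum_congr rfl fun l hl => ?_
  obtain ⟨l', rfl⟩ := Nat.exists_eq_add_of_le (Nat.lt_succ_iff.mp (Finset.mem_range.mp hl))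
  rw [Nat.add_sub_cancel_left, show s + (l + l') = (s + l) + l' by ring,
    show t + (l + l') = (t + l') + l by ring]
  push_cast
  simp only [Nat.cast_add_choose]
  field_simp

/-! ### Schur's lemma -/

/-- The element `diag(e^(iθ), e^(-iθ))` of the maximal torus. -/
noncomputable def diagSU2 (θ : ℝ) : SU2 :=
  ⟨!![Complex.exp (θ * Complex.I), 0; 0, Complex.exp (-(θ * Complex.I))], by
    rw [Matrix.mem_specialUnitaryGroup_iff, Matrix.mem_unitaryGroup_iff]
    constructor
    · ext i j
      fin_cases i <;> fin_cases j <;>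
        simp [Matrix.mul_apply, Fin.sum_univ_two, Matrix.star_apply, ← Complex.exp_conj,
          ← Complex.exp_add]
    · simp [Matrix.det_fin_two, ← Complex.exp_add]⟩

/-- The rotation with first column `(3/5, 4/5)`; what matters is that neither entry vanishes. -/
noncomputable def rotSU2 : SU2 :=
  ⟨!![3 / 5, -(4 / 5); 4 / 5, 3 / 5], by
    rw [Matrix.mem_specialUnitaryGroup_iff, Matrix.mem_unitaryGroup_iff]
    constructor
    · ext i j
      fin_cases i <;> fin_cases j <;>
        simp [Matrix.mul_apply, Fin.sum_univ_two, Matrix.star_apply, map_ofNat] <;> norm_num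
    · simp [Matrix.det_fin_two]; norm_num⟩

theorem spinRep_diagSU2 (n : ℕ) (θ : ℝ) :
    spinRep n (diagSU2 θ) = Matrix.diagonal fun l : Fin (n + 1) =>
      Complex.exp ((2 * (l : ℕ) - n : ℂ) * θ * Complex.I) := by
  rw [spinRep_eq_wignerMatrix]
  refine eq_of_mulVec_cohVec fun u => ?_
  rw [wignerMatrix_mulVec_cohVec]
  ext l
  rw [mulVec_diagonal]
  simp only [cohVec, diagSU2, Matrix.mulVec, dotProduct, Fin.sum_univ_two, Matrix.of_apply,
    Matrix.cons_val', Matrix.cons_val_zero, Matrix.cons_val_one, Matrix.cons_val_fin_one,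
    zero_mul, add_zero, zero_add, mul_pow, ← Complex.exp_nat_mul]
  have : Complex.exp ((2 * (l : ℕ) - n : ℂ) * θ * Complex.I) =
      Complex.exp ((l : ℕ) * (θ * Complex.I)) *
        Complex.exp (((n - (l : ℕ) : ℕ) : ℂ) * -(θ * Complex.I)) := by
    rw [← Complex.exp_add, Nat.cast_sub (Nat.lt_succ_iff.mp l.2)]
    congr 1
    ring
  rw [this]
  ring

theorem wignerMatrix_apply_last (n : ℕ) (A : Matrix (Fin 2) (Fin 2) ℂ) (p : Fin (n + 1)) :
    wignerMatrix n A p (Fin.last n) = cohVec n (fun i => A i 0) p := by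
  have h : cohVec n ![1, 0] = Pi.single (Fin.last n) 1 := by
    ext l
    by_cases hl : l = Fin.last n
    · subst hl; simp [cohVec]
    · have : (l : ℕ) < n := Fin.val_lt_last hl
      simp [cohVec, hl, Nat.sub_eq_zero_iff_le, this]
  have := congrFun (wignerMatrix_mulVec_cohVec n A ![1, 0]) p
  rw [h, mulVec_single_one] at this
  refine this.trans (congrFun (congrArg _ ?_) p)
  ext i
  simp [Matrix.mulVec, dotProduct, Fin.sum_univ_two]

theorem spinRep_rotSU2_apply_last_ne_zero (n : ℕ) (p : Fin (n + 1)) :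
    spinRep n rotSU2 p (Fin.last n) ≠ 0 := by
  rw [spinRep_eq_wignerMatrix, wignerMatrix_apply_last]
  refine mul_ne_zero (sqrt_choose_ne_zero (Nat.lt_succ_iff.mp p.2)) ?_
  simp [rotSU2]

/-- An intertwiner preserves weights, by commutation with the diagonal torus. -/
theorem intertwiner_apply_eq_zero {k l : ℕ} {X : Matrix (Fin (k + 1)) (Fin (l + 1)) ℂ}
    (hX : ∀ g : SU2, spinRep k g * X = X * spinRep l g) {p : Fin (k + 1)} {q : Fin (l + 1)}
    (hpq : (2 * (p : ℕ) - k : ℤ) ≠ 2 * (q : ℕ) - l) : X p q = 0 := by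
  set M : ℤ := (2 * (p : ℕ) - k) - (2 * (q : ℕ) - l) with hM
  have hM0 : (M : ℂ) ≠ 0 := by
    have : M ≠ 0 := sub_ne_zero.mpr hpq
    exact_mod_cast this
  have h := congrFun (congrFun (hX (diagSU2 (Real.pi / M))) p) q
  rw [spinRep_diagSU2, spinRep_diagSU2, diagonal_mul, mul_diagonal] at h
  -- at the angle `π / M` the two weights differ by the sign `exp (iπ)`
  have e : (2 * (p : ℕ) - k : ℂ) * (Real.pi / M : ℝ) * Complex.I =
      (2 * (q : ℕ) - l : ℂ) * (Real.pi / M : ℝ) * Complex.I + Real.pi * Complex.I := by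
    have hMc : (M : ℂ) = (2 * (p : ℕ) - k) - (2 * (q : ℕ) - l) := by rw [hM]; push_cast; ring
    have : (Real.pi : ℂ) * Complex.I = M * (Real.pi / M) * Complex.I := by field_simp
    push_cast
    rw [this]
    nth_rewrite 3 [hMc]
    ring
  rw [e, Complex.exp_add, Complex.exp_pi_mul_I, mul_comm (X p q)] at h
  have h2 : Complex.exp ((2 * (q : ℕ) - l : ℂ) * (Real.pi / M : ℝ) * Complex.I) * X p q = 0 := by
    linear_combination (-1 / 2 : ℂ) * h
  exact (mul_eq_zero.mp h2).resolve_left (Complex.exp_ne_zero _)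

/-- Evaluation of an intertwiner on the vector `g |l,l⟩`, whose components are all nonzero for
`g = rotSU2`: its entries are determined by its last column. -/
theorem intertwiner_last_column {k l : ℕ} {X : Matrix (Fin (k + 1)) (Fin (l + 1)) ℂ}
    (hX : ∀ g : SU2, spinRep k g * X = X * spinRep l g) {p : Fin (k + 1)} {q : Fin (l + 1)}
    (hpq : (2 * (p : ℕ) - k : ℤ) = 2 * (q : ℕ) - l) :
    X p q * spinRep l rotSU2 q (Fin.last l) =
      ∑ p', spinRep k rotSU2 p p' * X p' (Fin.last l) := by
  have h := congrFun (congrFun (hX rotSU2) p) (Fin.last l)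
  rw [mul_apply, mul_apply] at h
  rw [h, Finset.sum_eq_single q (fun q' _ hq' => ?_) fun hq => absurd (Finset.mem_univ q) hq]
  rw [intertwiner_apply_eq_zero hX, zero_mul]
  intro h'
  exact hq' (Fin.ext (by omega))

/-- The highest weight `l` exceeds every weight of spin `k / 2`, so the last column vanishes. -/
theorem intertwiner_eq_zero_of_lt {k l : ℕ} (hkl : k < l)
    {X : Matrix (Fin (k + 1)) (Fin (l + 1)) ℂ}
    (hX : ∀ g : SU2, spinRep k g * X = X * spinRep l g) : X = 0 := by
  ext p q
  by_cases hpq : (2 * (p : ℕ) - k : ℤ) = 2 * (q : ℕ) - l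
  · have h := intertwiner_last_column hX hpq
    rw [Finset.sum_eq_zero] at h
    · exact (mul_eq_zero.mp h).resolve_right (spinRep_rotSU2_apply_last_ne_zero _ _)
    · intro p' _
      rw [intertwiner_apply_eq_zero hX, mul_zero]
      have := p'.2
      rw [Fin.val_last]
      omega
  · exact intertwiner_apply_eq_zero hX hpq

theorem intertwiner_conjTranspose {k l : ℕ} {X : Matrix (Fin (k + 1)) (Fin (l + 1)) ℂ}
    (hX : ∀ g : SU2, spinRep k g * X = X * spinRep l g) (g : SU2) :
    spinRep l g * Xᴴ = Xᴴ * spinRep k g := by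
  have h := congrArg conjTranspose (hX g⁻¹)
  rw [conjTranspose_mul, conjTranspose_mul, spinRep_inv, spinRep_inv, conjTranspose_conjTranspose,
    conjTranspose_conjTranspose] at h
  exact h.symm

/-- **Schur's lemma** for inequivalent spins. -/
theorem intertwiner_eq_zero {k l : ℕ} (hkl : k ≠ l) {X : Matrix (Fin (k + 1)) (Fin (l + 1)) ℂ}
    (hX : ∀ g : SU2, spinRep k g * X = X * spinRep l g) : X = 0 := by
  rcases lt_or_gt_of_ne hkl with h | h
  · exact intertwiner_eq_zero_of_lt h hX
  · exact conjTranspose_eq_zero.mp (intertwiner_eq_zero_of_lt h (intertwiner_conjTranspose hX))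

/-- **Schur's lemma** for a single spin. -/
theorem intertwiner_eq_smul_one {k : ℕ} {X : Matrix (Fin (k + 1)) (Fin (k + 1)) ℂ}
    (hX : ∀ g : SU2, spinRep k g * X = X * spinRep k g) :
    X = X (Fin.last k) (Fin.last k) • (1 : Matrix (Fin (k + 1)) (Fin (k + 1)) ℂ) := by
  ext p q
  by_cases hpq : p = q
  · subst hpq
    have h := intertwiner_last_column hX (p := p) (q := p) rfl
    rw [Finset.sum_eq_single (Fin.last k) (fun p' _ hp' => ?_) (by simp), mul_comm] at h
    · simpa using mul_left_cancel₀ (spinRep_rotSU2_apply_last_ne_zero _ _) h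
    · rw [intertwiner_apply_eq_zero hX, mul_zero]
      intro h'
      exact hp' (Fin.ext (by omega))
  · rw [intertwiner_apply_eq_zero hX, Matrix.smul_apply, one_apply_ne hpq, smul_zero]
    intro h'
    exact hpq (Fin.ext (by omega))

/-! ### Averaging over `SU(2)` and Schur orthogonality -/

instance haarSU2_isProbabilityMeasure : IsProbabilityMeasure haarSU2 :=
  ⟨by simpa [haarSU2] using
    Measure.haarMeasure_self (K₀ := (⊤ : TopologicalSpace.PositiveCompacts SU2))⟩

instance haarSU2_isHaarMeasure : haarSU2.IsHaarMeasure := by unfold haarSU2; infer_instance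

theorem continuous_coeff_pow {T : Type*} [TopologicalSpace T] {P : T → Polynomial ℂ}
    (hP : ∀ k, Continuous fun t => (P t).coeff k) (n k : ℕ) :
    Continuous fun t => (P t ^ n).coeff k := by
  induction n generalizing k with
  | zero => simp only [pow_zero]; exact continuous_const
  | succ n ih =>
    simp only [pow_succ, Polynomial.coeff_mul]
    exact continuous_finsetSum _ fun x _ => (ih x.1).mul (hP x.2)

theorem continuous_spinRep (n : ℕ) : Continuous (spinRep n) := by
  have hA : ∀ i j : Fin 2, Continuous fun g : SU2 => (g : Matrix (Fin 2) (Fin 2) ℂ) i j :=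
    fun i j => continuous_subtype_val.matrix_elem i j
  have hlin : ∀ j k, Continuous fun g : SU2 =>
      (Polynomial.C ((g : Matrix (Fin 2) (Fin 2) ℂ) 0 j) * Polynomial.X +
        Polynomial.C ((g : Matrix (Fin 2) (Fin 2) ℂ) 1 j)).coeff k := fun j k => by
    simp only [Polynomial.coeff_add, Polynomial.coeff_C_mul, Polynomial.coeff_C]
    refine ((hA 0 j).mul continuous_const).add ?_
    split_ifs
    exacts [hA 1 j, continuous_const]
  refine continuous_matrix fun k l => continuous_const.mul ?_
  simp only [Polynomial.coeff_mul]
  exact continuous_finsetSum _ fun x _ => (continuous_coeff_pow (hlin 0) _ _).mul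
    (continuous_coeff_pow (hlin 1) _ _)

theorem integrable_of_continuous {f : SU2 → ℂ} (hf : Continuous f) : Integrable f haarSU2 :=
  hf.integrable_of_hasCompactSupport (HasCompactSupport.of_compactSpace f)

/-- The average `∫ D_k(g) M D_l(g)ᴴ dg`, entry by entry. -/
noncomputable def spinAverage {k l : ℕ} (M : Matrix (Fin (k + 1)) (Fin (l + 1)) ℂ) :
    Matrix (Fin (k + 1)) (Fin (l + 1)) ℂ :=
  Matrix.of fun p q => ∫ g, (spinRep k g * M * (spinRep l g)ᴴ) p q ∂haarSU2

theorem integrable_spinAverage {k l : ℕ} (M : Matrix (Fin (k + 1)) (Fin (l + 1)) ℂ)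
    (p : Fin (k + 1)) (q : Fin (l + 1)) :
    Integrable (fun g => (spinRep k g * M * (spinRep l g)ᴴ) p q) haarSU2 :=
  integrable_of_continuous <| Continuous.matrix_elem
    (((continuous_spinRep k).matrix_mul continuous_const).matrix_mul
      (continuous_spinRep l).matrix_conjTranspose) p q

theorem spinAverage_intertwines {k l : ℕ} (M : Matrix (Fin (k + 1)) (Fin (l + 1)) ℂ) (h : SU2) :
    spinRep k h * spinAverage M = spinAverage M * spinRep l h := by
  have key : spinRep k h * spinAverage M * (spinRep l h)ᴴ = spinAverage M := by
    ext p q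
    have e : ∀ g, (spinRep k (h * g) * M * (spinRep l (h * g))ᴴ) p q =
        ∑ q', (∑ p', spinRep k h p p' * (spinRep k g * M * (spinRep l g)ᴴ) p' q') *
          (spinRep l h)ᴴ q' q := fun g => by
      simp only [← mul_apply]
      rw [map_mul, map_mul, conjTranspose_mul]
      simp only [Matrix.mul_assoc]
    rw [spinAverage, of_apply, ← integral_mul_left_eq_self _ h]
    simp only [e]
    rw [integral_finsetSum]
    · rw [mul_apply]
      refine Finset.sum_congr rfl fun q' _ => ?_
      rw [integral_mul_const, integral_finsetSum, mul_apply]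
      · simp only [integral_const_mul, of_apply]
      · exact fun p' _ => (integrable_spinAverage M p' q').const_mul _
    · exact fun q' _ => (integrable_finsetSum _ fun p' _ =>
        (integrable_spinAverage M p' q').const_mul _).mul_const _
  calc spinRep k h * spinAverage M
      = spinRep k h * spinAverage M * ((spinRep l h)ᴴ * spinRep l h) := by
        rw [spinRep_conjTranspose_mul, Matrix.mul_one]
    _ = spinAverage M * spinRep l h := by rw [← Matrix.mul_assoc, key]

theorem trace_spinAverage {k : ℕ} (M : Matrix (Fin (k + 1)) (Fin (k + 1)) ℂ) :
    (spinAverage M).trace = M.trace := by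
  have e : ∀ g, ∑ p, (spinRep k g * M * (spinRep k g)ᴴ) p p = M.trace := fun g => by
    change (spinRep k g * M * (spinRep k g)ᴴ).trace = _
    rw [trace_mul_comm, ← Matrix.mul_assoc, spinRep_conjTranspose_mul, Matrix.one_mul]
  simp only [trace, diag_apply, spinAverage, of_apply]
  rw [← integral_finsetSum _ fun p _ => integrable_spinAverage M p p]
  simp [e, trace]

theorem spinDim_ne_zero (n : ℕ) : spinDim n ≠ 0 := by
  unfold spinDim; exact_mod_cast n.succ_ne_zero

/-- **Schur orthogonality**, for inequivalent spins. -/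
theorem spinAverage_eq_zero {k l : ℕ} (hkl : k ≠ l) (M : Matrix (Fin (k + 1)) (Fin (l + 1)) ℂ) :
    spinAverage M = 0 :=
  intertwiner_eq_zero hkl (spinAverage_intertwines M)

/-- **Schur orthogonality**, for a single spin. -/
theorem spinAverage_eq_smul_one {k : ℕ} (M : Matrix (Fin (k + 1)) (Fin (k + 1)) ℂ) :
    spinAverage M = (M.trace / spinDim k) • (1 : Matrix (Fin (k + 1)) (Fin (k + 1)) ℂ) := by
  have h := intertwiner_eq_smul_one (spinAverage_intertwines M)
  have ht := trace_spinAverage M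
  rw [h, trace_smul, trace_one, Fintype.card_fin, smul_eq_mul] at ht
  rw [h, ← ht]
  congr 1
  have := spinDim_ne_zero k
  rw [eq_div_iff this, spinDim]
  simp

/-! ### Clebsch-Gordan maps -/

theorem couplingMap_equivariant_SU2 (r s t : ℕ) (g : SU2) :
    (spinRep (s + r) g ⊗ₖ spinRep (t + r) g) * couplingMap r s t =
      couplingMap r s t * spinRep (s + t) g :=
  couplingMap_equivariant r s t (Matrix.mem_specialUnitaryGroup_iff.mp g.2).2

theorem couplingMap_transpose_equivariant (r s t : ℕ) (g : SU2) :
    (couplingMap r s t)ᵀ * (spinRep (s + r) g ⊗ₖ spinRep (t + r) g) =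
      spinRep (s + t) g * (couplingMap r s t)ᵀ := by
  have hdet : ((g : Matrix (Fin 2) (Fin 2) ℂ)ᵀ).det = 1 := by
    rw [det_transpose]; exact (Matrix.mem_specialUnitaryGroup_iff.mp g.2).2
  have h := congrArg transpose (couplingMap_equivariant r s t hdet)
  rw [transpose_mul, transpose_mul, ← kroneckerMap_transpose, ← wignerMatrix_transpose,
    ← wignerMatrix_transpose, ← wignerMatrix_transpose, transpose_transpose] at h
  exact h

theorem couplingMap_conjTranspose (r s t : ℕ) : (couplingMap r s t)ᴴ = (couplingMap r s t)ᵀ := by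
  ext m pq
  simp [couplingMap]

/-- The squared norm of the highest weight column, whose entries are
`± (r choose l) / √((s+r choose s+l) (t+r choose t+r-l))`. -/
theorem couplingMap_transpose_mul_last (r s t : ℕ) :
    ((couplingMap r s t)ᵀ * couplingMap r s t) (Fin.last _) (Fin.last _) = couplingNorm r s t := by
  rw [mul_apply]
  simp only [transpose_apply, couplingMap, of_apply, ← Complex.ofReal_mul, ← Complex.ofReal_sum]
  congr 1
  rw [Fintype.sum_prod_type]
  simp only [Fin.val_last, Nat.choose_self, Nat.cast_one, Real.sqrt_one, mul_one]
  set f : ℕ → ℕ → ℝ := fun p q =>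
    couplingCoeff r s t p q (s + t) / (√((s + r).choose p) * √((t + r).choose q)) *
    (couplingCoeff r s t p q (s + t) / (√((s + r).choose p) * √((t + r).choose q))) with hf
  change ∑ p : Fin (s + r + 1), ∑ q : Fin (t + r + 1), f p q = _
  rw [← Finset.sum_range fun p => ∑ q : Fin (t + r + 1), f p q]
  simp only [← Finset.sum_range (f _)]
  rw [add_assoc s r 1, Finset.sum_range_add, Finset.sum_eq_zero, zero_add,
    ← sum_couplingCoeff_last_sq]
  · refine Finset.sum_congr rfl fun l hl => ?_
    have hl' := Nat.lt_succ_iff.mp (Finset.mem_range.mp hl)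
    rw [Finset.sum_eq_single (t + (r - l)), hf]
    · simp only []
      rw [couplingCoeff_last _ _ _ _ hl', div_mul_div_comm,
        mul_mul_mul_comm (√_), Real.mul_self_sqrt (Nat.cast_nonneg _),
        Real.mul_self_sqrt (Nat.cast_nonneg _), mul_mul_mul_comm, ← mul_pow]
      norm_num [sq]
    · intro q _ hq
      simp only [hf]
      rw [couplingCoeff_eq_zero (by omega)]
      simp
    · intro h; rw [Finset.mem_range] at h; omega
  · intro p hp
    refine Finset.sum_eq_zero fun q _ => ?_
    simp only [hf]
    rw [couplingCoeff_last_eq_zero (Finset.mem_range.mp hp)]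
    simp

theorem couplingMap_transpose_mul (r s t : ℕ) :
    (couplingMap r s t)ᵀ * couplingMap r s t =
      (couplingNorm r s t : ℂ) • (1 : Matrix (Fin (s + t + 1)) (Fin (s + t + 1)) ℂ) := by
  rw [← couplingMap_transpose_mul_last]
  refine intertwiner_eq_smul_one fun g => ?_
  rw [← Matrix.mul_assoc, ← couplingMap_transpose_equivariant, Matrix.mul_assoc,
    couplingMap_equivariant_SU2, Matrix.mul_assoc]

/-- The positive factor that turns the transpose of `couplingMap` into the Clebsch-Gordan map. -/
noncomputable def cgScale (r s t : ℕ) : ℝ := (√((s + t + 1 : ℝ) * couplingNorm r s t))⁻¹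

theorem cgScale_pos (r s t : ℕ) : 0 < cgScale r s t :=
  inv_pos.mpr (Real.sqrt_pos.mpr (mul_pos (by positivity) (couplingNorm_pos r s t)))

theorem weightIndex_eq {n : ℕ} {M : ℤ} {p : ℕ} (hp : p ≤ n) (h : (n + M) = 2 * p) :
    weightIndex n M = ⟨p, Nat.lt_succ_of_le hp⟩ := by
  apply Fin.ext
  rw [weightIndex, h]
  simp only [Fin.ofNat]
  rw [Nat.mod_eq_of_lt] <;> omega

theorem weightIndex_self (n : ℕ) : weightIndex n n = Fin.last n :=
  weightIndex_eq le_rfl (by omega)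

theorem isClebschGordan_couplingMap (r s t : ℕ) :
    IsClebschGordan (s + r) (t + r) (s + t)
      ((cgScale r s t : ℂ) • (couplingMap r s t)ᵀ) := by
  have hentry : ((cgScale r s t : ℂ) • (couplingMap r s t)ᵀ) (weightIndex (s + t) ↑(s + t))
      (weightIndex (s + r) ↑(s + r), weightIndex (t + r) (↑(s + t) - ↑(s + r))) =
      ((cgScale r s t * (1 / √((t + r).choose t)) : ℝ) : ℂ) := by
    rw [weightIndex_self, weightIndex_self,
      weightIndex_eq (p := t) (by omega) (by push_cast; ring)]
    have := couplingCoeff_last r s t r le_rfl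
    simp only [Nat.sub_self, add_zero, Nat.choose_self, pow_zero, mul_one, Nat.cast_one] at this
    simp [couplingMap, this]
  refine ⟨fun g => ?_, ?_, ?_, ?_⟩
  · rw [Matrix.smul_mul, couplingMap_transpose_equivariant, Matrix.mul_smul]
  · rw [conjTranspose_smul, ← couplingMap_conjTranspose, conjTranspose_conjTranspose,
      couplingMap_conjTranspose, Matrix.smul_mul, Matrix.mul_smul, couplingMap_transpose_mul,
      smul_smul, smul_smul]
    congr 1
    have hN := couplingNorm_pos r s t
    have h : cgScale r s t * (cgScale r s t * couplingNorm r s t) = ((s + t : ℕ) + 1 : ℝ)⁻¹ := by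
      rw [cgScale, ← mul_assoc, ← mul_inv, Real.mul_self_sqrt (by positivity)]
      push_cast
      field_simp
    rw [Complex.star_def, Complex.conj_ofReal, spinDim, mul_assoc]
    have h' := congrArg Complex.ofReal h
    push_cast at h' ⊢
    exact h'
  · rw [hentry, Complex.ofReal_im]
  · rw [hentry, Complex.ofReal_re]
    have : 0 < (t + r).choose t := Nat.choose_pos (by omega)
    have := cgScale_pos r s t
    positivity

theorem exists_of_mem_coupledSpins {a b k : ℕ} (h : k ∈ coupledSpins a b) :
    ∃ r s t, a = s + r ∧ b = t + r ∧ k = s + t := by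
  simp only [coupledSpins, Finset.mem_filter, Finset.mem_range] at h
  -- `m` is half of `a + b + k`, that is `r + s + t`
  obtain ⟨h1, h2, h3, m, hm⟩ := h
  exact ⟨m - k, m - b, m - a, by omega, by omega, by omega⟩

theorem isClebschGordan_clebschGordan {a b k : ℕ} (h : k ∈ coupledSpins a b) :
    IsClebschGordan a b k (clebschGordan a b k) := by
  have hex : ∃ C, IsClebschGordan a b k C := by
    obtain ⟨r, s, t, rfl, rfl, rfl⟩ := exists_of_mem_coupledSpins h
    exact ⟨_, isClebschGordan_couplingMap r s t⟩
  rw [clebschGordan, dif_pos hex]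
  exact hex.choose_spec

theorem kronecker_spinRep_conjTranspose (a b : ℕ) (g : SU2) :
    (spinRep a g ⊗ₖ spinRep b g)ᴴ = spinRep a g⁻¹ ⊗ₖ spinRep b g⁻¹ := by
  rw [conjTranspose_kronecker, spinRep_inv, spinRep_inv]

theorem isEquivariantMap_conjTranspose {a b k : ℕ}
    {C : Matrix (Fin (k + 1)) (Fin (a + 1) × Fin (b + 1)) ℂ}
    (hC : ∀ g : SU2, C * (spinRep a g ⊗ₖ spinRep b g) = spinRep k g * C) :
    IsEquivariantMap a b k Cᴴ := fun g => by
  have h := congrArg conjTranspose (hC g⁻¹)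
  rw [conjTranspose_mul, conjTranspose_mul, kronecker_spinRep_conjTranspose, inv_inv,
    spinRep_inv, conjTranspose_conjTranspose] at h
  exact h

theorem intertwiner_of_equivariant {a b k l : ℕ}
    {C : Matrix (Fin (k + 1)) (Fin (a + 1) × Fin (b + 1)) ℂ}
    {F : Matrix (Fin (a + 1) × Fin (b + 1)) (Fin (l + 1)) ℂ}
    (hC : ∀ g : SU2, C * (spinRep a g ⊗ₖ spinRep b g) = spinRep k g * C)
    (hF : IsEquivariantMap a b l F) (g : SU2) :
    spinRep k g * (C * F) = C * F * spinRep l g := by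
  rw [← Matrix.mul_assoc, ← hC, Matrix.mul_assoc, hF, Matrix.mul_assoc]

theorem clebschGordan_mul_conjTranspose_of_ne {a b k l : ℕ} (hk : k ∈ coupledSpins a b)
    (hl : l ∈ coupledSpins a b) (hkl : k ≠ l) :
    clebschGordan a b k * (clebschGordan a b l)ᴴ = 0 :=
  intertwiner_eq_zero hkl <| intertwiner_of_equivariant
    (isClebschGordan_clebschGordan hk).equivariant
    (isEquivariantMap_conjTranspose (isClebschGordan_clebschGordan hl).equivariant)

/-- The dimensions of the coupled spins add up to that of the tensor product. -/
theorem sum_coupledSpins (a b : ℕ) : ∑ k ∈ coupledSpins a b, (k + 1) = (a + 1) * (b + 1) := by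
  wlog hab : b ≤ a generalizing a b
  · rw [mul_comm, ← this b a (by omega)]
    refine Finset.sum_congr ?_ fun _ _ => rfl
    ext k
    simp only [coupledSpins, Finset.mem_filter, Finset.mem_range, add_comm b a]
    tauto
  obtain ⟨c, rfl⟩ := Nat.exists_eq_add_of_le hab
  -- the coupled spins are `c, c + 2, …, c + 2 b` with `c = a - b`
  have himg : coupledSpins (b + c) b = (Finset.range (b + 1)).image fun i => c + 2 * i := by
    ext k
    simp only [coupledSpins, Finset.mem_filter, Finset.mem_range, Finset.mem_image]
    constructor
    · rintro ⟨h1, h2, h3, m, hm⟩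
      exact ⟨m - b - c, by omega, by omega⟩
    · rintro ⟨i, hi, rfl⟩
      exact ⟨by omega, by omega, by omega, b + c + i, by ring⟩
  rw [himg, Finset.sum_image fun i _ j _ h => by simpa using h]
  have : ∀ m, ∑ i ∈ Finset.range m, (c + 2 * i + 1) = m * (c + m) := fun m => by
    induction m with
    | zero => simp
    | succ m ih => rw [Finset.sum_range_succ, ih]; ring
  rw [this]
  ring

open scoped ComplexOrder in
/-- The Clebsch-Gordan decomposition: the left side is a Hermitian projection, since different spins
are orthogonal, and its trace is the full dimension. -/
theorem sum_clebschGordan (a b : ℕ) :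
    ∑ k ∈ coupledSpins a b, spinDim k • ((clebschGordan a b k)ᴴ * clebschGordan a b k) = 1 := by
  set P := ∑ k ∈ coupledSpins a b, spinDim k • ((clebschGordan a b k)ᴴ * clebschGordan a b k)
    with hP
  have hdim : ∀ k, star (spinDim k) = spinDim k := fun k => by simp [spinDim]
  have hPh : Pᴴ = P := by
    simp only [hP, conjTranspose_sum, conjTranspose_smul, conjTranspose_mul,
      conjTranspose_conjTranspose, hdim]
  -- the cross terms vanish by Schur's lemma and `d_k C Cᴴ = 1` takes care of the others
  have hPP : P * P = P := by
    nth_rewrite 1 [hP]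
    rw [Matrix.sum_mul]
    refine Finset.sum_congr rfl fun k hk => ?_
    rw [hP, Matrix.mul_sum, Finset.sum_eq_single k]
    · rw [Matrix.smul_mul, Matrix.mul_smul, Matrix.mul_assoc, ← Matrix.mul_assoc _ _ᴴ,
        (isClebschGordan_clebschGordan hk).normalized, Matrix.smul_mul, Matrix.one_mul,
        Matrix.mul_smul, smul_smul (spinDim k) (spinDim k)⁻¹, mul_inv_cancel₀ (spinDim_ne_zero k),
        one_smul]
    · intro l hl hlk
      rw [Matrix.smul_mul, Matrix.mul_smul, Matrix.mul_assoc, ← Matrix.mul_assoc _ _ᴴ,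
        clebschGordan_mul_conjTranspose_of_ne hk hl hlk.symm, Matrix.zero_mul, Matrix.mul_zero,
        smul_zero, smul_zero]
    · exact fun h => absurd hk h
  have htr : P.trace = ((a + 1) * (b + 1) : ℕ) := by
    rw [hP, trace_sum, ← sum_coupledSpins, Nat.cast_sum]
    refine Finset.sum_congr rfl fun k hk => ?_
    rw [trace_smul, trace_mul_comm, (isClebschGordan_clebschGordan hk).normalized, trace_smul,
      smul_smul, mul_inv_cancel₀ (spinDim_ne_zero k), one_smul, trace_one, Fintype.card_fin]
  have hzero : (1 - P)ᴴ * (1 - P) = 1 - P := by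
    rw [conjTranspose_sub, conjTranspose_one, hPh, Matrix.sub_mul, Matrix.mul_sub, Matrix.mul_sub,
      hPP]
    simp
  refine (sub_eq_zero.mp (trace_conjTranspose_mul_self_eq_zero_iff.mp ?_)).symm
  rw [hzero, trace_sub, htr, trace_one, Fintype.card_prod, Fintype.card_fin, Fintype.card_fin,
    sub_self]

/-- Each coupled spin occurs with multiplicity one. -/
theorem eq_smul_conjTranspose_of_isEquivariantMap {a b k : ℕ} (hk : k ∈ coupledSpins a b)
    {F : Matrix (Fin (a + 1) × Fin (b + 1)) (Fin (k + 1)) ℂ} (hF : IsEquivariantMap a b k F) :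
    ∃ z : ℂ, F = z • (clebschGordan a b k)ᴴ := by
  have hz := intertwiner_eq_smul_one (intertwiner_of_equivariant
    (isClebschGordan_clebschGordan hk).equivariant hF)
  set z := (clebschGordan a b k * F) (Fin.last k) (Fin.last k)
  refine ⟨spinDim k * z, ?_⟩
  rw [← Matrix.one_mul F, ← sum_clebschGordan, Matrix.sum_mul, Finset.sum_eq_single k]
  · rw [Matrix.smul_mul, Matrix.mul_assoc, hz, Matrix.mul_smul, Matrix.mul_one, smul_smul]
  · intro l hl hlk
    rw [Matrix.smul_mul, Matrix.mul_assoc, intertwiner_eq_zero hlk (intertwiner_of_equivariant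
      (isClebschGordan_clebschGordan hl).equivariant hF), Matrix.mul_zero, smul_zero]
  · exact fun h => absurd hk h

/-- The normalisation and the Condon-Shortley phase determine the Clebsch-Gordan map. -/
theorem eq_clebschGordan {a b k : ℕ} (hk : k ∈ coupledSpins a b)
    {C : Matrix (Fin (k + 1)) (Fin (a + 1) × Fin (b + 1)) ℂ} (hC : IsClebschGordan a b k C) :
    C = clebschGordan a b k := by
  have hD := isClebschGordan_clebschGordan hk
  obtain ⟨w, hw⟩ := eq_smul_conjTranspose_of_isEquivariantMap hk
    (isEquivariantMap_conjTranspose hC.equivariant)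
  obtain ⟨z, hz⟩ : ∃ z : ℂ, C = z • clebschGordan a b k :=
    ⟨star w, by rw [← conjTranspose_conjTranspose C, hw, conjTranspose_smul,
      conjTranspose_conjTranspose]⟩
  have hzz : z * star z = 1 := by
    have h := hC.normalized
    rw [hz, conjTranspose_smul, Matrix.smul_mul, Matrix.mul_smul, hD.normalized, smul_smul,
      smul_smul] at h
    have h0 := congrFun (congrFun h 0) 0
    simp only [Matrix.smul_apply, one_apply_eq, smul_eq_mul, mul_one] at h0
    exact mul_right_cancel₀ (inv_ne_zero (spinDim_ne_zero k)) (by rw [h0, one_mul])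
  -- the phase convention makes `z` a positive real
  have hCim := hC.phase_im
  have hCre := hC.phase_re
  have hDim := hD.phase_im
  have hDre := hD.phase_re
  rw [hz] at hCim hCre
  simp only [Matrix.smul_apply, smul_eq_mul, Complex.mul_im, Complex.mul_re, hDim, mul_zero,
    zero_add, sub_zero] at hCim hCre
  have him : z.im = 0 := (mul_eq_zero.mp hCim).resolve_right hDre.ne'
  have hre : 0 < z.re := pos_of_mul_pos_left hCre hDre.le
  have hsq : z.re * z.re = 1 := by
    have := congrArg Complex.re hzz
    simpa [him] using this
  have h1 : z = 1 := Complex.ext (by simp; nlinarith) (by simpa using him)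
  rw [hz, h1, one_smul]

theorem clebschGordan_eq_couplingMap (r s t : ℕ)
    (h : s + t ∈ coupledSpins (s + r) (t + r)) :
    clebschGordan (s + r) (t + r) (s + t) = (cgScale r s t : ℂ) • (couplingMap r s t)ᵀ :=
  (eq_clebschGordan h (isClebschGordan_couplingMap r s t)).symm

theorem clebschGordan_apply_eq_zero {a b k : ℕ} (hk : k ∈ coupledSpins a b) {m : Fin (k + 1)}
    {p : Fin (a + 1)} {q : Fin (b + 1)} (h : (2 * m - k : ℤ) ≠ (2 * p - a) + (2 * q - b)) :
    clebschGordan a b k m (p, q) = 0 := by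
  obtain ⟨r, s, t, rfl, rfl, rfl⟩ := exists_of_mem_coupledSpins hk
  rw [clebschGordan_eq_couplingMap r s t hk, Matrix.smul_apply, transpose_apply, couplingMap,
    of_apply, couplingCoeff_eq_zero (p := p) (q := q) (by omega)]
  simp

/-- The extremal coefficient comes from the single monomial
`x₀ ^ (s+r) y₁ ^ (t+r) u₀ ^ s u₁ ^ t` of the generating function, whose coefficient is `1`. -/
theorem cgCoeff_extremal {a b k : ℕ} (hk : k ∈ coupledSpins a b) :
    cgCoeff a b k a (-b) (a - b) =
        ((Real.sqrt ((a.factorial * b.factorial : ℝ) /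
          (((a + b - k) / 2).factorial * ((a + b + k) / 2 + 1).factorial : ℝ)) : ℝ) : ℂ) := by
  obtain ⟨r, s, t, rfl, rfl, rfl⟩ := exists_of_mem_coupledSpins hk
  rw [cgCoeff, clebschGordan_eq_couplingMap r s t hk, weightIndex_self,
    weightIndex_eq (p := s) (by omega) (by push_cast; ring),
    weightIndex_eq (p := 0) (by omega) (by push_cast; ring)]
  rw [Matrix.smul_apply, transpose_apply, couplingMap, of_apply]
  simp only [Fin.val_last, couplingCoeff_extremal, Nat.choose_self, Nat.choose_zero_right,
    Nat.cast_one, Real.sqrt_one, one_mul, smul_eq_mul, ← Complex.ofReal_mul]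
  congr 1
  have e1 : (s + r + (t + r) - (s + t)) / 2 = r := by omega
  have e2 : (s + r + (t + r) + (s + t)) / 2 + 1 = s + t + 1 + r := by omega
  rw [e1, e2, cgScale, one_div, ← mul_inv, ← Real.sqrt_mul
    (mul_nonneg (by positivity) (couplingNorm_pos r s t).le), ← Real.sqrt_inv]
  congr 1
  rw [couplingNorm, Nat.cast_add_choose, Nat.factorial_succ (s + t)]
  push_cast
  field_simp

/-! ### The coherent-state intertwiners -/

/-- Averaging commutes with multiplication by constant matrices on both sides. -/
theorem integral_conj_average {ι : Type*} {k l : ℕ} (B : Matrix ι (Fin (k + 1)) ℂ)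
    (M : Matrix (Fin (k + 1)) (Fin (l + 1)) ℂ) (D : Matrix (Fin (l + 1)) ι ℂ) (p q : ι) :
    Integrable (fun g => (B * (spinRep k g * M * (spinRep l g)ᴴ) * D) p q) haarSU2 ∧
      ∫ g, (B * (spinRep k g * M * (spinRep l g)ᴴ) * D) p q ∂haarSU2 =
        (B * spinAverage M * D) p q := by
  have hi : ∀ m n, Integrable (fun g => B p n *
      (spinRep k g * M * (spinRep l g)ᴴ) n m) haarSU2 := fun m n =>
    (integrable_spinAverage M n m).const_mul _
  have hi' : ∀ m, Integrable (fun g => (∑ n, B p n *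
      (spinRep k g * M * (spinRep l g)ᴴ) n m) * D m q) haarSU2 := fun m =>
    (integrable_finsetSum _ fun n _ => hi m n).mul_const _
  have e : ∀ g, (B * (spinRep k g * M * (spinRep l g)ᴴ) * D) p q =
      ∑ m, (∑ n, B p n * (spinRep k g * M * (spinRep l g)ᴴ) n m) * D m q := fun g => by
    simp only [← mul_apply]
  simp only [e]
  refine ⟨integrable_finsetSum _ fun m _ => hi' m, ?_⟩
  rw [integral_finsetSum _ fun m _ => hi' m, mul_apply]
  refine Finset.sum_congr rfl fun m _ => ?_
  rw [integral_mul_const, integral_finsetSum _ fun n _ => hi m n, mul_apply]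
  simp only [integral_const_mul, spinAverage, of_apply]

/-- The average of a rank one operator over an orbit in the tensor product. The off-diagonal blocks
in the Clebsch-Gordan decomposition vanish and the diagonal ones are scalars, by Schur
orthogonality. -/
theorem ketBraIntegral_orbit (a b : ℕ) (v : Fin (a + 1) × Fin (b + 1) → ℂ) :
    ketBraIntegral (fun g => (spinRep a g ⊗ₖ spinRep b g) *ᵥ v) =
      ∑ k ∈ coupledSpins a b,
        (spinDim k * (star (clebschGordan a b k *ᵥ v) ⬝ᵥ (clebschGordan a b k *ᵥ v))) •
          ((clebschGordan a b k)ᴴ * clebschGordan a b k) := by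
  set C := clebschGordan a b
  have hexp : ∀ g : SU2, (spinRep a g ⊗ₖ spinRep b g) *ᵥ v =
      ∑ k ∈ coupledSpins a b, spinDim k • ((C k)ᴴ *ᵥ (spinRep k g *ᵥ (C k *ᵥ v))) := fun g => by
    conv_lhs => rw [← Matrix.one_mul (spinRep a g ⊗ₖ spinRep b g), ← sum_clebschGordan]
    rw [Matrix.sum_mul, sum_mulVec]
    refine Finset.sum_congr rfl fun k hk => ?_
    rw [Matrix.smul_mul, smul_mulVec, Matrix.mul_assoc,
      (isClebschGordan_clebschGordan hk).equivariant, mulVec_mulVec, mulVec_mulVec,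
      Matrix.mul_assoc]
  have hdim : ∀ k, star (spinDim k) = spinDim k := fun k => by simp [spinDim]
  have hvec : ∀ g : SU2, vecMulVec ((spinRep a g ⊗ₖ spinRep b g) *ᵥ v)
      (star ((spinRep a g ⊗ₖ spinRep b g) *ᵥ v)) =
      ∑ k ∈ coupledSpins a b, ∑ l ∈ coupledSpins a b, (spinDim k * spinDim l) •
        ((C k)ᴴ * (spinRep k g * vecMulVec (C k *ᵥ v) (star (C l *ᵥ v)) * (spinRep l g)ᴴ) *
          C l) := fun g => by
    rw [hexp]
    ext p q
    simp only [vecMulVec_apply, Pi.star_apply, Finset.sum_apply, star_sum, Finset.sum_mul_sum,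
      Matrix.sum_apply]
    refine Finset.sum_congr rfl fun k _ => Finset.sum_congr rfl fun l _ => ?_
    rw [mul_vecMulVec, vecMulVec_mul, mul_vecMulVec, vecMulVec_mul, ← star_mulVec,
      ← conjTranspose_conjTranspose (C l), ← star_mulVec, conjTranspose_conjTranspose]
    simp only [Matrix.smul_apply, vecMulVec_apply, Pi.smul_apply, Pi.star_apply, smul_eq_mul,
      star_mul', hdim]
    ring
  have hsum : ketBraIntegral (fun g => (spinRep a g ⊗ₖ spinRep b g) *ᵥ v) =
      ∑ k ∈ coupledSpins a b, ∑ l ∈ coupledSpins a b, (spinDim k * spinDim l) •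
        ((C k)ᴴ * spinAverage (vecMulVec (C k *ᵥ v) (star (C l *ᵥ v))) * C l) := by
    ext p q
    simp only [ketBraIntegral, of_apply, hvec, Matrix.sum_apply, Matrix.smul_apply, smul_eq_mul]
    have hi : ∀ k l, Integrable (fun g => (spinDim k * spinDim l) *
        ((C k)ᴴ * (spinRep k g * vecMulVec (C k *ᵥ v) (star (C l *ᵥ v)) * (spinRep l g)ᴴ) *
          C l) p q) haarSU2 := fun k l => (integral_conj_average _ _ _ p q).1.const_mul _
    rw [integral_finsetSum _ fun k _ => integrable_finsetSum _ fun l _ => hi k l]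
    refine Finset.sum_congr rfl fun k _ => ?_
    rw [integral_finsetSum _ fun l _ => hi k l]
    refine Finset.sum_congr rfl fun l _ => ?_
    rw [integral_const_mul, (integral_conj_average _ _ _ p q).2]
  rw [hsum]
  refine Finset.sum_congr rfl fun k hk => ?_
  rw [Finset.sum_eq_single k]
  · rw [spinAverage_eq_smul_one, trace_vecMulVec, dotProduct_comm, Matrix.mul_smul, Matrix.mul_one,
      Matrix.smul_mul, smul_smul]
    congr 1
    have := spinDim_ne_zero k
    field_simp
  · intro l _ hlk
    rw [spinAverage_eq_zero hlk.symm, Matrix.mul_zero, Matrix.zero_mul, smul_zero]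
  · exact fun h => absurd hk h

theorem tensorVec_ket (a b : ℕ) (M N : ℤ) :
    tensorVec (ket a M) (ket b N) = Pi.single (weightIndex a M, weightIndex b N) 1 := by
  ext ⟨p, q⟩
  by_cases hp : p = weightIndex a M <;> by_cases hq : q = weightIndex b N <;>
    simp [tensorVec, ket, hp, hq]

/-- A basis vector of the tensor product has only one nonzero component in the spin
`k / 2` summand, by weight conservation. -/
theorem star_dotProduct_clebschGordan_single {a b k : ℕ} (hk : k ∈ coupledSpins a b)
    {m : Fin (k + 1)} {p : Fin (a + 1)} {q : Fin (b + 1)}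
    (h : (2 * m - k : ℤ) = (2 * p - a) + (2 * q - b)) :
    star (clebschGordan a b k *ᵥ Pi.single (p, q) 1) ⬝ᵥ
      (clebschGordan a b k *ᵥ Pi.single (p, q) 1) =
        ((‖clebschGordan a b k m (p, q)‖ ^ 2 : ℝ) : ℂ) := by
  rw [mulVec_single_one, dotProduct, Finset.sum_eq_single m]
  · rw [Pi.star_apply, col_apply, Complex.star_def, ← Complex.normSq_eq_conj_mul_self,
      Complex.normSq_eq_norm_sq]
  · intro m' _ hm'
    rw [col_apply, clebschGordan_apply_eq_zero hk, mul_zero]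
    rw [← h]
    intro h'
    exact hm' (Fin.ext (by omega))
  · exact fun h => absurd (Finset.mem_univ m) h

theorem add_mem_coupledSpins (a b : ℕ) : a + b ∈ coupledSpins a b := by
  simp only [coupledSpins, Finset.mem_filter, Finset.mem_range]
  exact ⟨by omega, by omega, by omega, ⟨a + b, by ring⟩⟩

/-- Only the product of highest weight vectors reaches the highest weight of spin `(a + b) / 2`. -/
theorem norm_sq_clebschGordan_last (a b : ℕ) :
    ((‖clebschGordan a b (a + b) (Fin.last _) (Fin.last _, Fin.last _)‖ ^ 2 : ℝ) : ℂ) =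
      (spinDim (a + b))⁻¹ := by
  have hk := add_mem_coupledSpins a b
  have h := congrFun (congrFun (isClebschGordan_clebschGordan hk).normalized (Fin.last _))
    (Fin.last _)
  rw [Matrix.smul_apply, one_apply_eq, smul_eq_mul, mul_one, mul_apply,
    Finset.sum_eq_single (Fin.last _, Fin.last _)] at h
  · rw [← h, conjTranspose_apply, Complex.star_def, Complex.mul_conj, Complex.normSq_eq_norm_sq]
  · rintro ⟨p, q⟩ _ hpq
    rw [clebschGordan_apply_eq_zero hk, zero_mul]
    intro h'
    rw [Fin.val_last] at h'
    have := p.2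
    have := q.2
    refine hpq (Prod.ext (Fin.ext ?_) (Fin.ext ?_)) <;> simp only [Fin.val_last] <;> omega
  · exact fun h => absurd (Finset.mem_univ _) h

theorem parallelIntertwiner_eq (a b : ℕ) :
    parallelIntertwiner a b =
      (spinDim a * spinDim b) • ((clebschGordan a b (a + b))ᴴ * clebschGordan a b (a + b)) := by
  have hψ : (fun g => tensorVec (coherentState a g) (coherentState b g)) = fun g =>
      (spinRep a g ⊗ₖ spinRep b g) *ᵥ Pi.single (Fin.last a, Fin.last b) 1 := by
    ext1 g
    rw [← weightIndex_self, ← weightIndex_self, ← tensorVec_ket, kronecker_mulVec_tensorVec]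
    rfl
  rw [parallelIntertwiner, hψ, ketBraIntegral_orbit, Finset.sum_eq_single (a + b)]
  · rw [star_dotProduct_clebschGordan_single (add_mem_coupledSpins a b) (m := Fin.last _),
      norm_sq_clebschGordan_last, mul_inv_cancel₀ (spinDim_ne_zero _), one_smul]
    simp only [Fin.val_last]
    push_cast
    ring
  · intro k hk hkab
    have : clebschGordan a b k *ᵥ Pi.single (Fin.last a, Fin.last b) 1 = 0 := by
      ext m
      rw [mulVec_single_one, col_apply, clebschGordan_apply_eq_zero hk, Pi.zero_apply]
      simp only [coupledSpins, Finset.mem_filter, Finset.mem_range] at hk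
      have := m.2
      simp only [Fin.val_last]
      omega
    rw [this, dotProduct_zero, mul_zero, zero_smul]
  · exact fun h => absurd (add_mem_coupledSpins a b) h

theorem antiparallelIntertwiner_eq (a b : ℕ) :
    antiparallelIntertwiner a b =
      (spinDim a * spinDim b) • ∑ k ∈ coupledSpins a b,
        (spinDim k * ((‖cgCoeff a b k a (-b) (a - b)‖ ^ 2 : ℝ) : ℂ)) •
          ((clebschGordan a b k)ᴴ * clebschGordan a b k) := by
  have hψ : ketBraIntegral (fun g => tensorVec (coherentState a g) (conjCoherentState b g)) =
      ketBraIntegral fun g => (spinRep a g ⊗ₖ spinRep b g) *ᵥ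
        Pi.single (weightIndex a a, weightIndex b (-b)) 1 := by
    have e : ∀ g, tensorVec (coherentState a g) (conjCoherentState b g) = (-1 : ℂ) ^ b •
        ((spinRep a g ⊗ₖ spinRep b g) *ᵥ Pi.single (weightIndex a a, weightIndex b (-b)) 1) := by
      intro g
      rw [← tensorVec_ket, kronecker_mulVec_tensorVec]
      ext ⟨p, q⟩
      simp only [tensorVec, conjCoherentState, coherentState, Pi.smul_apply, smul_eq_mul]
      ring
    -- the sign of the conjugate coherent state cancels between ket and bra
    have hsign : (-1 : ℂ) ^ b * star ((-1 : ℂ) ^ b) = 1 := by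
      simp [← mul_pow]
    ext p q
    simp only [ketBraIntegral, of_apply, e, vecMulVec_apply, Pi.star_apply, Pi.smul_apply,
      smul_eq_mul, star_mul', mul_mul_mul_comm _ _ (star ((-1 : ℂ) ^ b))]
    simp only [hsign, one_mul]
  rw [antiparallelIntertwiner, hψ, ketBraIntegral_orbit]
  congr 1
  refine Finset.sum_congr rfl fun k hk => ?_
  rw [star_dotProduct_clebschGordan_single hk (m := weightIndex k (a - b)), cgCoeff]
  obtain ⟨r, s, t, rfl, rfl, rfl⟩ := exists_of_mem_coupledSpins hk
  rw [weightIndex_self, weightIndex_eq (p := s) (by omega) (by push_cast; ring),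
    weightIndex_eq (p := 0) (by omega) (by push_cast; ring)]
  simp only [Fin.val_last]
  push_cast
  ring

/-- Two different spins do not couple to spin `0`. -/
theorem not_containsTrivialRep {a b : ℕ} (hab : a ≠ b)
    (A : Matrix (Fin (a + 1) × Fin (b + 1)) (Fin (a + 1) × Fin (b + 1)) ℂ) :
    ¬ ContainsTrivialRep a b A := by
  rintro ⟨v, -, hv0, hv⟩
  refine hv0 ?_
  have h0 : ∀ g : SU2, spinRep 0 g = 1 := fun g => by
    ext i j
    fin_cases i; fin_cases j
    simp [spinRep, wignerEntry]
  -- a fixed vector is an equivariant map from spin `0`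
  have hF : IsEquivariantMap a b 0 (Matrix.of fun p _ => v p) := fun g => by
    rw [h0, Matrix.mul_one]
    ext p q
    exact congrFun (hv g) p
  have hC : ∀ k ∈ coupledSpins a b, clebschGordan a b k *ᵥ v = 0 := fun k hk => by
    have hk0 : k ≠ 0 := by
      simp only [coupledSpins, Finset.mem_filter, Finset.mem_range] at hk
      omega
    have h := intertwiner_eq_zero hk0 (intertwiner_of_equivariant
      (isClebschGordan_clebschGordan hk).equivariant hF)
    ext m
    exact congrFun (congrFun h m) 0
  rw [← one_mulVec v, ← sum_clebschGordan, sum_mulVec]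
  refine Finset.sum_eq_zero fun k hk => ?_
  rw [smul_mulVec, ← mulVec_mulVec, hC k hk, mulVec_zero, smul_zero]

theorem spinComponent_eq {a b k : ℕ} (hk : k ∈ coupledSpins a b) :
    spinComponent a b k = LinearMap.range (clebschGordan a b k)ᴴ.mulVecLin := by
  refine le_antisymm (iSup_le fun ⟨F, hF⟩ => ?_) ?_
  · obtain ⟨z, rfl⟩ := eq_smul_conjTranspose_of_isEquivariantMap hk hF
    rintro _ ⟨x, rfl⟩
    exact ⟨z • x, by simp⟩
  · exact le_iSup (fun F : {F // IsEquivariantMap a b k F} => LinearMap.range F.1.mulVecLin)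
      ⟨_, isEquivariantMap_conjTranspose (isClebschGordan_clebschGordan hk).equivariant⟩

theorem range_parallelIntertwiner (a b : ℕ) :
    LinearMap.range (parallelIntertwiner a b).mulVecLin = spinComponent a b (a + b) := by
  have hk := add_mem_coupledSpins a b
  have hd : spinDim a * spinDim b ≠ 0 := mul_ne_zero (spinDim_ne_zero a) (spinDim_ne_zero b)
  rw [spinComponent_eq hk, parallelIntertwiner_eq]
  set C := clebschGordan a b (a + b) with hC
  apply le_antisymm
  · rintro _ ⟨x, rfl⟩
    exact ⟨(spinDim a * spinDim b) • (C *ᵥ x), by simp [mulVec_mulVec]⟩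
  · rintro _ ⟨x, rfl⟩
    -- `d_k C Cᴴ = 1` exhibits `Cᴴ x` as `Cᴴ C (d_k Cᴴ x)`
    refine ⟨((spinDim a * spinDim b)⁻¹ * spinDim (a + b)) • (Cᴴ *ᵥ x), ?_⟩
    simp only [mulVecLin_apply]
    rw [mulVec_smul, smul_mulVec, mulVec_mulVec, Matrix.mul_assoc,
      (isClebschGordan_clebschGordan hk).normalized, Matrix.mul_smul, Matrix.mul_one, smul_mulVec,
      smul_smul, smul_smul]
    have := spinDim_ne_zero (a + b)
    rw [show (spinDim a * spinDim b)⁻¹ * spinDim (a + b) * (spinDim a * spinDim b) *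
      (spinDim (a + b))⁻¹ = 1 by field_simp; exact div_self hd, one_smul]

theorem isStarProjection_parallelIntertwiner (a b : ℕ) :
    IsStarProjection ((spinDim (a + b) / (spinDim a * spinDim b)) • parallelIntertwiner a b) := by
  have hk := add_mem_coupledSpins a b
  have hd : spinDim a * spinDim b ≠ 0 := mul_ne_zero (spinDim_ne_zero a) (spinDim_ne_zero b)
  have hdk := spinDim_ne_zero (a + b)
  rw [parallelIntertwiner_eq, smul_smul, div_mul_cancel₀ _ hd]
  set C := clebschGordan a b (a + b) with hC
  constructor
  · change _ * _ = _
    rw [Matrix.smul_mul, Matrix.mul_smul, Matrix.mul_assoc, ← Matrix.mul_assoc C,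
      (isClebschGordan_clebschGordan hk).normalized, Matrix.smul_mul, Matrix.one_mul,
      Matrix.mul_smul, smul_smul (spinDim (a + b)) (spinDim (a + b))⁻¹, mul_inv_cancel₀ hdk,
      one_smul]
  · change _ᴴ = _
    rw [conjTranspose_smul, conjTranspose_mul, conjTranspose_conjTranspose]
    simp [spinDim]

theorem coupledSpins_zero_right (a : ℕ) : coupledSpins a 0 = {a} := by
  ext k
  simp only [coupledSpins, Finset.mem_filter, Finset.mem_range, Finset.mem_singleton]
  constructor
  · rintro ⟨h1, h2, -⟩; omega
  · rintro rfl; exact ⟨by omega, by omega, by omega, ⟨k, by ring⟩⟩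

theorem intertwiners_zero_right (a : ℕ) :
    parallelIntertwiner a 0 = 1 ∧ antiparallelIntertwiner a 0 = 1 := by
  have h1 := sum_clebschGordan a 0
  rw [coupledSpins_zero_right, Finset.sum_singleton] at h1
  have hd0 : spinDim 0 = 1 := by simp [spinDim]
  have hd := spinDim_ne_zero a
  constructor
  · rw [parallelIntertwiner_eq, hd0, mul_one]
    exact h1
  · have hcoeff : ((‖cgCoeff a 0 a a (-(0 : ℕ)) (a - (0 : ℕ))‖ ^ 2 : ℝ) : ℂ) = (spinDim a)⁻¹ := by
      have hq : (0 : ℝ) ≤ (a.factorial * (Nat.factorial 0) : ℝ) /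
          (((a + 0 - a) / 2).factorial * ((a + 0 + a) / 2 + 1).factorial : ℝ) := by positivity
      rw [cgCoeff_extremal (by rw [coupledSpins_zero_right, Finset.mem_singleton]),
        Complex.norm_real, Real.norm_of_nonneg (Real.sqrt_nonneg _), Real.sq_sqrt hq]
      rw [show (a + 0 - a) / 2 = 0 by omega, show (a + 0 + a) / 2 + 1 = a + 1 by omega,
        Nat.factorial_succ]
      simp only [Nat.factorial_zero, spinDim]
      push_cast
      have : (a.factorial : ℂ) ≠ 0 := by exact_mod_cast a.factorial_ne_zero
      field_simp
    rw [antiparallelIntertwiner_eq, coupledSpins_zero_right, Finset.sum_singleton, hcoeff, hd0,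
      mul_inv_cancel₀ hd, one_smul, mul_one, h1]

theorem ImmirziSpins.ne {γ : ℝ} (hγ : 0 < γ) {n a b : ℕ} (h : ImmirziSpins γ n a b)
    (hn : 0 < n) : a ≠ b := by
  rintro rfl
  obtain ⟨ha, hb⟩ := h
  rw [ha] at hb
  have hn' : ((n : ℝ) / 2) ≠ 0 := by positivity
  have h := mul_right_cancel₀ hn' hb
  rw [immirziPlus, immirziMinus, div_left_inj' hγ.ne'] at h
  rcases abs_choice (1 - γ) with h' | h' <;> rw [h'] at h <;> linarith

theorem ImmirziSpins.of_one {n a b : ℕ} (h : ImmirziSpins 1 n a b) : a = 2 * n ∧ b = 0 := by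
  obtain ⟨ha, hb⟩ := h
  simp only [immirziPlus, immirziMinus] at ha hb
  norm_num at ha hb
  refine ⟨?_, hb⟩
  have : (a : ℝ) = 2 * n := by linarith
  exact_mod_cast this

theorem mainTheorem8 :
    -- the Clebsch-Gordan maps exist, and the relevant coefficient is given in closed form
    (∀ a b k : ℕ, k ∈ coupledSpins a b →
      IsClebschGordan a b k (clebschGordan a b k) ∧
      cgCoeff a b k a (-b) (a - b) =
        ((Real.sqrt ((a.factorial * b.factorial : ℝ) /
          (((a + b - k) / 2).factorial * ((a + b + k) / 2 + 1).factorial : ℝ)) : ℝ) : ℂ)) ∧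
    -- the case `γ < 1`
    (∀ (γ : ℝ) (n a b : ℕ), 0 < γ → γ < 1 → ImmirziSpins γ n a b →
      parallelIntertwiner a b =
        (spinDim a * spinDim b) • ((clebschGordan a b (a + b))ᴴ * clebschGordan a b (a + b)) ∧
      IsStarProjection ((spinDim (a + b) / (spinDim a * spinDim b)) • parallelIntertwiner a b) ∧
      LinearMap.range (parallelIntertwiner a b).mulVecLin = spinComponent a b (a + b) ∧
      (0 < n → ¬ ContainsTrivialRep a b (parallelIntertwiner a b))) ∧
    -- the case `γ > 1`
    (∀ (γ : ℝ) (n a b : ℕ), 1 < γ → ImmirziSpins γ n a b →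
      antiparallelIntertwiner a b =
        (spinDim a * spinDim b) • ∑ k ∈ coupledSpins a b,
          (spinDim k * ((‖cgCoeff a b k a (-b) (a - b)‖ ^ 2 : ℝ) : ℂ)) •
            ((clebschGordan a b k)ᴴ * clebschGordan a b k) ∧
      (0 < n → ¬ ContainsTrivialRep a b (antiparallelIntertwiner a b))) ∧
    -- the case `γ = 1`, where `j⁺ = 2j` and `j⁻ = 0`
    (∀ n a b : ℕ, ImmirziSpins 1 n a b →
      a = 2 * n ∧ b = 0 ∧ parallelIntertwiner a b = 1 ∧ antiparallelIntertwiner a b = 1) ∧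
    -- indeed both are the identity whenever `j⁻ = 0`, for any half-integer `j⁺`
    (∀ a : ℕ, parallelIntertwiner a 0 = 1 ∧ antiparallelIntertwiner a 0 = 1) := by
  refine ⟨fun a b k hk => ⟨isClebschGordan_clebschGordan hk, cgCoeff_extremal hk⟩,
    fun γ n a b h0 h1 h => ⟨parallelIntertwiner_eq a b, isStarProjection_parallelIntertwiner a b,
      range_parallelIntertwiner a b, fun hn => not_containsTrivialRep (h.ne h0 hn) _⟩,
    fun γ n a b h1 h => ⟨antiparallelIntertwiner_eq a b,
      fun hn => not_containsTrivialRep (h.ne (zero_lt_one.trans h1) hn) _⟩,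
    fun n a b h => ?_, intertwiners_zero_right⟩
  obtain ⟨ha, rfl⟩ := h.of_one
  exact ⟨ha, rfl, intertwiners_zero_right a⟩
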